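/- Let $\mathcal H^2$ be the hyperbolic plane (the complete, simply connected Riemannian surface of constant curvature $-1$, in any model; $\mathrm{PSL}(2,\mathbb R)$ is its group of orientation-preserving isometries). Consider the two-body problem on $\mathcal H^2$ with masses $m_1,m_2>0$ and a constant $k>0$: the Lagrangian system on pairs of distinct points with $L=\tfrac12(m_1|v_1|^2+m_2|v_2|^2)+k\,m_1m_2\coth d$, where $d$ is the distance between the masses and $|v_i|$ is the hyperbolic norm of the velocity of the $i$-th mass. The hyperbolic center of mass of the two masses is the unique point $C$ of the geodesic segment joining them such that $m_1\sinh(2d_1)=m_2\sinh(2d_2)$, where $d_i$ is the distance from $C$ to $m_i$ (so $d=d_1+d_2$). An elliptic relative equilibrium is a solution of the form $q_i(t)=\exp(t\xi)\cdot q_i(0)$, $i=1,2$, where $\xi\in\mathfrak{sl}(2,\mathbb R)$ is elliptic, i.e. has eigenvalues $\pm i\omega/2$ with a real $\omega\neq0$. Two nonzero vectors $v_1,v_2$ that are perpendicular to a geodesic $\ell$ at two of its points are oppositely oriented if the bases $\{v_1,\dot\ell\}$ and $\{v_2,\dot\ell\}$ define opposite orientations. **Theorem.** (a) For every elliptic relative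 equilibrium, with $\omega$ as above, $$\omega^2=\frac{2km_1}{\sinh^2(d)\,\sinh(2d_2)}=\frac{2km_2}{\sinh^2(d)\,\sinh(2d_1)},\qquad(*)$$ and throughout the motion: (i) $d_1$ and $d_2$ are constant; (ii) the velocities $v_1,v_2$ are perpendicular to the unique geodesic containing the two masses and are oppositely oriented; (iii) the hyperbolic norm of $v_i$ is constant and equal to $|\omega|\sinh(d_i)$; (iv) the hyperbolic center of mass is fixed; (v) the motion is periodic with (least) period $2\pi/|\omega|$. (b) Conversely, let $X_1\neq X_2$ be points of $\mathcal H^2$, let $d_1,d_2$ be the distances from $X_1,X_2$ to the hyperbolic center of mass of the masses $m_1,m_2$ at $X_1,X_2$ (which exists and is unique), let $d=d_1+d_2$, and let $\omega$ satisfy $(*)$. If $V_1,V_2$ are tangent vectors at $X_1,X_2$ that are perpendicular to the geodesic through $X_1$ and $X_2$, oppositely oriented, and of norms $|\omega|\sinh(d_1)$, $|\omega|\sinh(d_2)$, then there is exactly one solution, defined for all times, with initial positions $X_1,X_2$ and initial velocities $V_1,V_2$, and it is an elliptic relative equilibrium with eigenvalues $\pm i\omega/2$. -/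

import Mathlib

/-!
Conventions.  A model of the hyperbolic plane is a metric space `M` together with an isometry
`e : M ≃ᵢ UpperHalfPlane` onto the upper half-plane with its Riemannian distance.  The distance,
the geodesics and the hyperbolic center of mass of `M` are defined from the metric of `M` alone.
The smooth structure, the Riemannian metric `(dx² + dy²) / y²`, the orientation (up to sign) and the
action of `SL(2, ℝ)` are those which `e` carries over; since isometries of the metric space
`UpperHalfPlane` are Riemannian isometries, they are the Riemannian data of `M`.
-/

namespace HypTwoBody

noncomputable section

/-- The global complex coordinate `x + i y`, `y > 0`, of a point of the model. -/
def coord {M : Type*} [MetricSpace M] (e : M ≃ᵢ UpperHalfPlane) (X : M) : ℂ :=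
  ((e X : UpperHalfPlane) : ℂ)

/-- The velocity of a curve, as a tangent vector written in the coordinate `x + i y`. -/
def velocity {M : Type*} [MetricSpace M] (e : M ≃ᵢ UpperHalfPlane) (γ : ℝ → M) (t : ℝ) : ℂ :=
  deriv (fun s => coord e (γ s)) t

/-- The Riemannian metric `(dx² + dy²) / y²` at the point `z`. -/
def metricInner (z v w : ℂ) : ℝ := (v.re * w.re + v.im * w.im) / z.im ^ 2

/-- The hyperbolic norm of a tangent vector `v` at the point `z`. -/
def metricNorm (z v : ℂ) : ℝ := Real.sqrt (metricInner z v v)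

/-- A complete geodesic, parametrized by arc length: an isometric embedding of the real line. -/
def IsGeodesic {M : Type*} [MetricSpace M] (ℓ : ℝ → M) : Prop := Isometry ℓ

/-- The sign of `orient v w` is the orientation of the basis `{v, w}` of the plane. -/
def orient (v w : ℂ) : ℝ := v.re * w.im - v.im * w.re

/-- The tangent vectors `V₁` at `X₁` and `V₂` at `X₂` are perpendicular to the geodesic through
`X₁` and `X₂` and are oppositely oriented: for a parametrization `ℓ` of the geodesic, the bases
`{V₁, ℓ'}` at `X₁` and `{V₂, ℓ'}` at `X₂` define opposite orientations of the plane. -/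
def PerpOpposite {M : Type*} [MetricSpace M] (e : M ≃ᵢ UpperHalfPlane) (X₁ X₂ : M) (V₁ V₂ : ℂ) :
    Prop :=
  (∃ ℓ : ℝ → M, IsGeodesic ℓ ∧ X₁ ∈ Set.range ℓ ∧ X₂ ∈ Set.range ℓ) ∧
  ∀ ℓ : ℝ → M, IsGeodesic ℓ → ∀ s₁ s₂ : ℝ, ℓ s₁ = X₁ → ℓ s₂ = X₂ →
    metricInner (coord e X₁) V₁ (velocity e ℓ s₁) = 0 ∧
    metricInner (coord e X₂) V₂ (velocity e ℓ s₂) = 0 ∧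
    orient V₁ (velocity e ℓ s₁) * orient V₂ (velocity e ℓ s₂) < 0

/-- `C` is the hyperbolic center of mass of the masses `m₁` at `X₁` and `m₂` at `X₂`: it lies on
the geodesic connecting `X₁` to `X₂`, and `m₁ sinh (2 d₁) = m₂ sinh (2 d₂)` for its distances
`d₁`, `d₂` to `X₁`, `X₂`. -/
def IsCenterOfMass {M : Type*} [MetricSpace M] (m₁ m₂ : ℝ) (X₁ X₂ C : M) : Prop :=
  (∃ ℓ : ℝ → M, IsGeodesic ℓ ∧ ∃ s₁ s s₂ : ℝ, s₁ ≤ s ∧ s ≤ s₂ ∧ ℓ s₁ = X₁ ∧ ℓ s = C ∧ ℓ s₂ = X₂) ∧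
  m₁ * Real.sinh (2 * dist X₁ C) = m₂ * Real.sinh (2 * dist X₂ C)

/-- The potential `V(d) = - k m₁ m₂ coth d`. -/
def potential (k m₁ m₂ d : ℝ) : ℝ := -(k * m₁ * m₂ * (Real.cosh d / Real.sinh d))

/-- The Lagrangian `L = (m₁ |v₁|² + m₂ |v₂|²) / 2 - V(d)` of the two-body problem, as a function of
the coordinates `z = (z₁, z₂)` of the particles and of their velocities `v = (v₁, v₂)`; only its
values at distinct points `z₁ ≠ z₂` of the upper half-plane matter, where
`UpperHalfPlane.ofComplex` is the identity. -/
def lagrangian (k m₁ m₂ : ℝ) (z v : ℂ × ℂ) : ℝ :=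
  (m₁ * metricInner z.1 v.1 v.1 + m₂ * metricInner z.2 v.2 v.2) / 2 -
    potential k m₁ m₂ (dist (UpperHalfPlane.ofComplex z.1) (UpperHalfPlane.ofComplex z.2))

/-- The Euler–Lagrange equations `d/dt (∂L/∂v) = ∂L/∂z` along the curve `γ`. -/
def EulerLagrange {E : Type*} [NormedAddCommGroup E] [NormedSpace ℝ E] (L : E → E → ℝ)
    (γ : ℝ → E) : Prop :=
  ∀ t : ℝ, HasDerivAt (fun s => fderiv ℝ (fun v => L (γ s) v) (deriv γ s))
    (fderiv ℝ (fun z => L z (deriv γ t)) (γ t)) t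

/-- `(q₁, q₂)` is a (collision-free) motion of the two-body problem. -/
structure IsMotion {M : Type*} [MetricSpace M] (e : M ≃ᵢ UpperHalfPlane) (k m₁ m₂ : ℝ)
    (q₁ q₂ : ℝ → M) : Prop where
  ne : ∀ t, q₁ t ≠ q₂ t
  contDiff : ContDiff ℝ 2 (fun t => (coord e (q₁ t), coord e (q₂ t)))
  eulerLagrange : EulerLagrange (lagrangian k m₁ m₂) (fun t => (coord e (q₁ t), coord e (q₂ t)))

/-- `ξ` is an elliptic element of `sl(2, ℝ)`, with the eigenvalues `± i ω / 2`, `ω ≠ 0`. -/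
def IsEllipticElement (ξ : LieAlgebra.SpecialLinear.sl (Fin 2) ℝ) (ω : ℝ) : Prop :=
  ω ≠ 0 ∧ spectrum ℂ ((ξ : Matrix (Fin 2) (Fin 2) ℝ).map (fun x => (x : ℂ))) =
    {Complex.I * (ω / 2), -(Complex.I * (ω / 2))}

/-- `(q₁, q₂)` is an elliptic relative equilibrium with velocity `ξ`, where `ξ` has the eigenvalues
`± i ω / 2`: a motion of the form `qᵢ(t) = exp(t ξ) · qᵢ(0)` for the action of `SL(2, ℝ)` by
Möbius transformations. -/
def IsEllipticRelEq {M : Type*} [MetricSpace M] (e : M ≃ᵢ UpperHalfPlane) (k m₁ m₂ : ℝ)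
    (q₁ q₂ : ℝ → M) (ξ : LieAlgebra.SpecialLinear.sl (Fin 2) ℝ) (ω : ℝ) : Prop :=
  IsMotion e k m₁ m₂ q₁ q₂ ∧ IsEllipticElement ξ ω ∧
  ∃ g : ℝ → Matrix.SpecialLinearGroup (Fin 2) ℝ, ∀ t : ℝ,
    (g t : Matrix (Fin 2) (Fin 2) ℝ) =
      NormedSpace.exp (t • (ξ : Matrix (Fin 2) (Fin 2) ℝ)) ∧
    e (q₁ t) = g t • e (q₁ 0) ∧ e (q₂ t) = g t • e (q₂ 0)

/-- The relation between `ω` and the distances `d₁`, `d₂` to the center of mass. -/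
def OmegaRelation (k m₁ m₂ d₁ d₂ ω : ℝ) : Prop :=
  ω ^ 2 = 2 * k * m₁ / (Real.sinh (d₁ + d₂) ^ 2 * Real.sinh (2 * d₂)) ∧
  ω ^ 2 = 2 * k * m₂ / (Real.sinh (d₁ + d₂) ^ 2 * Real.sinh (2 * d₁))

end

end HypTwoBody

/-! An elliptic one-parameter group fixes a point `p + i q`. The Cayley map `discMap p q` sends the
center of the unit disc to that point, and in this coordinate the group acts by `w ↦ exp(-iηt) w`
with `|η| = |ω|`. So a relative equilibrium is a pair of disc points turning rigidly about the
center, and everything reduces to algebra in `ℂ`.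

For the upper half-plane the Euler–Lagrange equations become `z'' = acceleration`, an explicit
formula (`eulerLagrange_lagrangian_iff`). Substituting rotating orbits turns them into one equation
per particle, `Balanced`. This equation is invariant under rotation, so it holds at all times as
soon as it holds at time zero (`isMotion_discOrbit_iff`).

The geometric heart is `Balanced.exists_opposite`. Each balance equation says that `(w - w')(1 - w *
conj w')` is a positive multiple of `w`. Multiplying by `conj w` makes the imaginary part of `w₂ *
conj w₁` vanish, and the positivity then forces this real number to be negative. The particles lie
on one diameter, on opposite sides of the center. With `w₁ = tanh(-r₁/2) u` and `w₂ = tanh(r₂/2) u`,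
the two balance equations are exactly the two formulas for `ω²` (`balanced_opposite_iff`). Equating
these gives `m₁ sinh(2r₁) = m₂ sinh(2r₂)`, so the center of rotation is the center of mass. Speeds,
perpendicularity and period are read off from the circular orbits.

For the converse, the disc is centered at the center of mass. Perpendicular, oppositely oriented
vectors of the given norms are the velocities of a single rotation (`PerpOpposite.exists_rotation`),
and the same equivalences show that this rotation is a motion. Uniqueness is that of solutions of an
ODE with a `C¹` right-hand side (`IsMotion.eq_of_initial`). -/

namespace HypTwoBody

noncomputable section

open Complex
open scoped ComplexConjugate

/-! ### Disc coordinates and the distance in them -/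

/-- The Cayley parametrization of the upper half-plane by the unit disc which maps the center of
the disc to `p + i q`. -/
def discMap (p q : ℝ) (w : ℂ) : ℂ := p + q * (I * ((1 + w) / (1 - w)))

/-- The point of the model with disc coordinate `w` relative to `p + i q`. -/
def discPoint {M : Type*} [MetricSpace M] (e : M ≃ᵢ UpperHalfPlane) (p q : ℝ) (w : ℂ) : M :=
  e.symm (UpperHalfPlane.ofComplex (discMap p q w))

theorem one_sub_ne_zero_of_normSq_lt {w : ℂ} (hw : normSq w < 1) : 1 - w ≠ 0 := by
  intro h
  have : w = 1 := by linear_combination -h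
  simp [this] at hw

theorem discMap_im (p q : ℝ) (w : ℂ) :
    (discMap p q w).im = q * (1 - normSq w) / normSq (1 - w) := by
  simp only [discMap, add_im, ofReal_im, mul_im, ofReal_re, I_re, I_im, div_im, div_re, mul_re,
    normSq_apply, sub_re, sub_im, add_re, one_re, one_im]
  ring

theorem discMap_im_pos (p : ℝ) {q : ℝ} (hq : 0 < q) {w : ℂ} (hw : normSq w < 1) :
    0 < (discMap p q w).im := by
  rw [discMap_im]
  have := normSq_pos.2 (one_sub_ne_zero_of_normSq_lt hw)
  have : 0 < 1 - normSq w := by linarith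
  positivity

theorem discMap_sub (p q : ℝ) {w w' : ℂ} (hw : normSq w < 1) (hw' : normSq w' < 1) :
    discMap p q w - discMap p q w' = 2 * I * q * (w - w') / ((1 - w) * (1 - w')) := by
  have h1 := one_sub_ne_zero_of_normSq_lt hw
  have h2 := one_sub_ne_zero_of_normSq_lt hw'
  simp only [discMap]
  field_simp
  ring

/-- With `discMap_sub`, this transports the factors `z - w` and `z - conj w` of the attraction to
the disc. -/
theorem discMap_sub_conj (p q : ℝ) {w w' : ℂ} (hw : normSq w < 1) (hw' : normSq w' < 1) :
    discMap p q w - conj (discMap p q w') =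
      2 * I * q * (1 - w * conj w') / ((1 - w) * (1 - conj w')) := by
  have h1 := one_sub_ne_zero_of_normSq_lt hw
  have h2 : 1 - conj w' ≠ 0 :=
    one_sub_ne_zero_of_normSq_lt (w := conj w') (by rwa [normSq_conj])
  simp only [discMap, map_add, map_mul, map_div₀, map_sub, map_one, conj_ofReal, conj_I]
  field_simp
  ring

theorem discMap_injective (p : ℝ) {q : ℝ} (hq : 0 < q) {w w' : ℂ} (hw : normSq w < 1)
    (hw' : normSq w' < 1) (h : discMap p q w = discMap p q w') : w = w' := by
  have h0 := discMap_sub p q hw hw'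
  rw [h, sub_self, eq_comm, div_eq_zero_iff] at h0
  have h1 := one_sub_ne_zero_of_normSq_lt hw
  have h2 := one_sub_ne_zero_of_normSq_lt hw'
  have hq' : (q : ℂ) ≠ 0 := by exact_mod_cast hq.ne'
  simp [h1, h2, hq'] at h0
  linear_combination h0

theorem exists_discMap_eq (p : ℝ) {q : ℝ} (hq : 0 < q) {z : ℂ} (hz : 0 < z.im) :
    ∃ w, normSq w < 1 ∧ discMap p q w = z := by
  have hq' : (q : ℂ) ≠ 0 := by exact_mod_cast hq.ne'
  have hd : z - p + I * q ≠ 0 := by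
    intro h
    have := congrArg im h
    simp at this
    linarith
  refine ⟨(z - p - I * q) / (z - p + I * q), ?_, ?_⟩
  · rw [normSq_div, div_lt_one (normSq_pos.2 hd)]
    simp only [normSq_apply, sub_re, sub_im, add_re, add_im, mul_re, mul_im, I_re, I_im,
      ofReal_re, ofReal_im]
    nlinarith [mul_pos hq hz]
  · have h1 : 1 - (z - p - I * q) / (z - p + I * q) = 2 * I * q / (z - p + I * q) := by
      field_simp; ring
    have h2 : 1 + (z - p - I * q) / (z - p + I * q) = 2 * (z - p) / (z - p + I * q) := by
      field_simp; ring
    rw [discMap, h1, h2, div_div_div_cancel_right₀ hd]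
    field_simp
    ring

section Model

variable {M : Type*} [MetricSpace M] (e : M ≃ᵢ UpperHalfPlane) (p : ℝ) {q : ℝ} (hq : 0 < q)

theorem coord_im_pos (X : M) : 0 < (coord e X).im := (e X).im_pos

theorem coord_injective : Function.Injective (coord e) := fun _ _ h =>
  e.injective (UpperHalfPlane.ext h)

include hq

theorem coord_discPoint {w : ℂ} (hw : normSq w < 1) :
    coord e (discPoint e p q w) = discMap p q w := by
  simp [coord, discPoint, UpperHalfPlane.ofComplex_apply_of_im_pos (discMap_im_pos p hq hw)]

theorem exists_discPoint_eq (X : M) : ∃ w, normSq w < 1 ∧ discPoint e p q w = X := by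
  obtain ⟨w, hw, h⟩ := exists_discMap_eq p hq (coord_im_pos e X)
  exact ⟨w, hw, coord_injective e (by rw [coord_discPoint e p hq hw, h])⟩

theorem discPoint_injective {w w' : ℂ} (hw : normSq w < 1) (hw' : normSq w' < 1)
    (h : discPoint e p q w = discPoint e p q w') : w = w' := by
  apply discMap_injective p hq hw hw'
  rw [← coord_discPoint e p hq hw, h, coord_discPoint e p hq hw']

omit hq in
theorem cosh_dist_eq_coord (X Y : M) : Real.cosh (dist X Y) =
    1 + normSq (coord e X - coord e Y) / (2 * (coord e X).im * (coord e Y).im) := by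
  rw [← e.isometry.dist_eq, UpperHalfPlane.cosh_dist, Complex.dist_eq, Complex.sq_norm]
  rfl

theorem cosh_dist_discPoint {w w' : ℂ} (hw : normSq w < 1) (hw' : normSq w' < 1) :
    Real.cosh (dist (discPoint e p q w) (discPoint e p q w')) =
      1 + 2 * normSq (w - w') / ((1 - normSq w) * (1 - normSq w')) := by
  have h1 := normSq_pos.2 (one_sub_ne_zero_of_normSq_lt hw)
  have h2 := normSq_pos.2 (one_sub_ne_zero_of_normSq_lt hw')
  have h3 : 1 - normSq w ≠ 0 := by linarith
  have h4 : 1 - normSq w' ≠ 0 := by linarith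
  rw [cosh_dist_eq_coord e, coord_discPoint e p hq hw, coord_discPoint e p hq hw',
    discMap_sub p q hw hw', discMap_im, discMap_im]
  simp only [normSq_div, normSq_mul, normSq_I, normSq_ofReal, normSq_ofNat]
  field_simp

end Model

/-! ### Geodesics through the center of the disc -/

theorem tanh_half_sq_lt_one (s : ℝ) : Real.tanh (s / 2) ^ 2 < 1 := Real.tanh_sq_lt_one _

theorem cosh_eq_tanh_half (s : ℝ) :
    Real.cosh s = (1 + Real.tanh (s / 2) ^ 2) / (1 - Real.tanh (s / 2) ^ 2) := by
  have h := Real.cosh_pos (s / 2)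
  have h1 : Real.cosh s = Real.cosh (s / 2) ^ 2 + Real.sinh (s / 2) ^ 2 := by
    rw [← Real.cosh_two_mul]; ring_nf
  have h2 := Real.cosh_sq (s / 2)
  rw [eq_div_iff (by linarith [tanh_half_sq_lt_one s]), h1, Real.tanh_eq_sinh_div_cosh]
  field_simp
  rw [h2]; ring

theorem sinh_eq_tanh_half (s : ℝ) :
    Real.sinh s = 2 * Real.tanh (s / 2) / (1 - Real.tanh (s / 2) ^ 2) := by
  have h := Real.cosh_pos (s / 2)
  have h1 : Real.sinh s = 2 * Real.sinh (s / 2) * Real.cosh (s / 2) := by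
    rw [← Real.sinh_two_mul]; ring_nf
  have h2 := Real.cosh_sq (s / 2)
  rw [eq_div_iff (by linarith [tanh_half_sq_lt_one s]), h1, Real.tanh_eq_sinh_div_cosh]
  field_simp
  rw [h2]; ring

theorem normSq_real_mul_unit (t : ℝ) {u : ℂ} (hu : normSq u = 1) : normSq (t * u) = t ^ 2 := by
  rw [normSq_mul, hu, normSq_ofReal]; ring

theorem normSq_tanh_mul_unit (s : ℝ) {u : ℂ} (hu : normSq u = 1) :
    normSq ((Real.tanh (s / 2) : ℝ) * u) < 1 := by
  rw [normSq_real_mul_unit _ hu]; exact tanh_half_sq_lt_one s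

/-- The geodesic through `p + i q` in the direction `u`. -/
def discGeodesic {M : Type*} [MetricSpace M] (e : M ≃ᵢ UpperHalfPlane) (p q : ℝ) (u : ℂ) (s : ℝ) :
    M := discPoint e p q ((Real.tanh (s / 2) : ℝ) * u)

section Geodesic

variable {M : Type*} [MetricSpace M] (e : M ≃ᵢ UpperHalfPlane) (p : ℝ) {q : ℝ} (hq : 0 < q)
include hq

/-- On the hyperboloid, `cosh` of the distance is the Minkowski product. The coefficients of `cosh
s` and `sinh s` are, up to sign, the time coordinate of `w` and its space coordinate along `u`. -/
theorem cosh_dist_discGeodesic {w u : ℂ} (hw : normSq w < 1) (hu : normSq u = 1) (s : ℝ) :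
    Real.cosh (dist (discPoint e p q w) (discGeodesic e p q u s)) =
      (1 + normSq w) / (1 - normSq w) * Real.cosh s
        - 2 * (w * conj u).re / (1 - normSq w) * Real.sinh s := by
  have h1 := tanh_half_sq_lt_one s
  have h3 : 1 - normSq w ≠ 0 := by linarith
  have h4 : 1 - Real.tanh (s / 2) ^ 2 ≠ 0 := by linarith
  rw [discGeodesic, cosh_dist_discPoint e p hq hw (normSq_tanh_mul_unit s hu),
    normSq_real_mul_unit _ hu, cosh_eq_tanh_half s, sinh_eq_tanh_half s, normSq_sub,
    normSq_real_mul_unit _ hu]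
  have : (w * conj ((Real.tanh (s / 2) : ℝ) * u)).re = Real.tanh (s / 2) * (w * conj u).re := by
    rw [map_mul, conj_ofReal, mul_left_comm, re_ofReal_mul]
  rw [this]
  field_simp
  ring

theorem dist_discGeodesic {u : ℂ} (hu : normSq u = 1) (s s' : ℝ) :
    dist (discGeodesic e p q u s) (discGeodesic e p q u s') = |s - s'| := by
  have h1 := tanh_half_sq_lt_one s
  have h : Real.cosh (dist (discGeodesic e p q u s) (discGeodesic e p q u s'))
      = Real.cosh (s - s') := by
    rw [discGeodesic, cosh_dist_discGeodesic e p hq (normSq_tanh_mul_unit s hu) hu,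
      normSq_real_mul_unit _ hu, Real.cosh_sub, ← cosh_eq_tanh_half, mul_assoc, mul_conj, hu,
      ofReal_one, mul_one, ofReal_re, ← sinh_eq_tanh_half]
  rw [← abs_of_nonneg (dist_nonneg (x := discGeodesic e p q u s))]
  rw [← Real.cosh_abs, ← Real.cosh_abs (s - s')] at h
  exact Real.cosh_strictMonoOn.injOn (Set.mem_Ici.2 (abs_nonneg _))
    (Set.mem_Ici.2 (abs_nonneg _)) h

theorem isGeodesic_discGeodesic {u : ℂ} (hu : normSq u = 1) :
    IsGeodesic (discGeodesic e p q u) :=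
  Isometry.of_dist_eq fun s s' => by rw [dist_discGeodesic e p hq hu, Real.dist_eq]

/-- The two distances give a linear system for the time coordinate `T` and the space coordinate `X`
of `P`, with determinant `sinh (s₁ - s₂) ≠ 0`. The values found leave no room for a component
perpendicular to `u`. -/
theorem eq_discGeodesic_of_dist_eq {u : ℂ} (hu : normSq u = 1) {s₁ s₂ s : ℝ} (hs : s₁ ≠ s₂) {P : M}
    (h₁ : dist P (discGeodesic e p q u s₁) = |s - s₁|)
    (h₂ : dist P (discGeodesic e p q u s₂) = |s - s₂|) : P = discGeodesic e p q u s := by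
  obtain ⟨w, hw, rfl⟩ := exists_discPoint_eq e p hq P
  have e₁ := cosh_dist_discGeodesic e p hq hw hu s₁
  have e₂ := cosh_dist_discGeodesic e p hq hw hu s₂
  rw [h₁, Real.cosh_abs, Real.cosh_sub] at e₁
  rw [h₂, Real.cosh_abs, Real.cosh_sub] at e₂
  set T := (1 + normSq w) / (1 - normSq w) with hT
  set X := 2 * (w * conj u).re / (1 - normSq w) with hX
  have hdet : Real.sinh (s₁ - s₂) ≠ 0 := by
    rw [Ne, Real.sinh_eq_zero, sub_eq_zero]; exact hs
  rw [Real.sinh_sub] at hdet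
  have hT' : T = Real.cosh s := by
    apply mul_right_cancel₀ hdet
    linear_combination Real.sinh s₂ * e₁ - Real.sinh s₁ * e₂
  have hX' : X = Real.sinh s := by
    apply mul_right_cancel₀ hdet
    linear_combination Real.cosh s₂ * e₁ - Real.cosh s₁ * e₂
  have hw1 : 1 - normSq w ≠ 0 := by linarith
  have h1 := tanh_half_sq_lt_one s
  have h4 : 1 - Real.tanh (s / 2) ^ 2 ≠ 0 := by linarith
  rw [hT, cosh_eq_tanh_half, div_eq_div_iff hw1 h4] at hT'
  have hN : normSq w = Real.tanh (s / 2) ^ 2 := by linarith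
  rw [hX, sinh_eq_tanh_half, hN, div_left_inj' h4] at hX'
  have hre : (w * conj u).re = Real.tanh (s / 2) := by linarith
  have hn : normSq (w * conj u) = Real.tanh (s / 2) ^ 2 := by
    rw [normSq_mul, normSq_conj, hu, hN, mul_one]
  rw [normSq_apply, hre] at hn
  have him : (w * conj u).im = 0 := by
    have : (w * conj u).im * (w * conj u).im = 0 := by linarith
    simpa using this
  have hwu : w * conj u = (Real.tanh (s / 2) : ℝ) := Complex.ext hre him
  have huu : conj u * u = 1 := by rw [mul_comm, mul_conj, hu, ofReal_one]
  rw [discGeodesic, ← hwu, mul_assoc, huu, mul_one]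

/-- Uniqueness of the geodesic through two points: every point of `ℓ` is determined by its distances
to them. Only the direction `ε` and the origin of the parameter remain free. -/
theorem isGeodesic_eq_discGeodesic {u : ℂ} (hu : normSq u = 1) {ℓ : ℝ → M} (hℓ : IsGeodesic ℓ)
    {r₁ r₂ s₁ s₂ : ℝ} (hr : r₁ ≠ r₂) (h₁ : ℓ s₁ = discGeodesic e p q u r₁)
    (h₂ : ℓ s₂ = discGeodesic e p q u r₂) :
    ∃ ε : ℝ, (ε = 1 ∨ ε = -1) ∧ ∀ s, ℓ s = discGeodesic e p q u (ε * (s - s₁) + r₁) := by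
  have hd : |s₁ - s₂| = |r₁ - r₂| := by
    rw [← Real.dist_eq, ← hℓ.dist_eq, h₁, h₂, dist_discGeodesic e p hq hu]
  have key : ∀ ε : ℝ, |ε| = 1 → r₂ - r₁ = ε * (s₂ - s₁) →
      ∀ s, ℓ s = discGeodesic e p q u (ε * (s - s₁) + r₁) := by
    intro ε hε hεr s
    apply eq_discGeodesic_of_dist_eq e p hq hu hr
    · rw [← h₁, hℓ.dist_eq, Real.dist_eq, add_sub_cancel_right, abs_mul, hε, one_mul]
    · rw [← h₂, hℓ.dist_eq, Real.dist_eq]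
      have : ε * (s - s₁) + r₁ - r₂ = ε * (s - s₂) := by linear_combination -hεr
      rw [this, abs_mul, hε, one_mul]
  rcases abs_eq_abs.1 hd with h | h
  · exact ⟨1, Or.inl rfl, key 1 (by simp) (by linarith)⟩
  · exact ⟨-1, Or.inr rfl, key (-1) (by simp) (by linarith)⟩

omit hq in
theorem discGeodesic_zero (u : ℂ) : discGeodesic e p q u 0 = discPoint e p q 0 := by
  simp [discGeodesic]

omit hq in
theorem exists_eq_tanh_mul_unit {w : ℂ} (hw : normSq w < 1) :
    ∃ u : ℂ, normSq u = 1 ∧ ∃ r : ℝ, 0 ≤ r ∧ w = (Real.tanh (r / 2) : ℝ) * u := by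
  have hr : ‖w‖ < 1 := by
    rw [← Complex.sq_norm] at hw
    exact (sq_lt_one_iff₀ (norm_nonneg w)).1 hw
  have hn := norm_nonneg w
  have ht : Real.tanh (2 * Real.artanh ‖w‖ / 2) = ‖w‖ := by
    rw [mul_div_cancel_left₀ _ two_ne_zero, Real.tanh_artanh ⟨by linarith, hr⟩]
  refine ⟨exp (arg w * I), ?_, 2 * Real.artanh ‖w‖, ?_, ?_⟩
  · rw [← Complex.sq_norm, norm_exp_ofReal_mul_I, one_pow]
  · have := Real.artanh_nonneg hn
    positivity
  · rw [ht, norm_mul_exp_arg_mul_I]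

theorem exists_discGeodesic_eq (X : M) :
    ∃ u : ℂ, normSq u = 1 ∧ X = discGeodesic e p q u (dist X (discPoint e p q 0)) := by
  obtain ⟨w, hw, rfl⟩ := exists_discPoint_eq e p hq X
  obtain ⟨u, hu, r, hr, rfl⟩ := exists_eq_tanh_mul_unit hw
  refine ⟨u, hu, ?_⟩
  change discGeodesic e p q u r = _
  have := dist_discGeodesic e p hq hu r 0
  rw [discGeodesic_zero e p, sub_zero, abs_of_nonneg hr] at this
  change _ = discGeodesic e p q u (dist (discGeodesic e p q u r) _)
  rw [this]

/-- Two points whose distances to `p + i q` add up to their distance lie on opposite sides of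
`p + i q` on a geodesic. -/
theorem exists_discGeodesic_eq_of_dist_add {X₁ X₂ : M}
    (h : dist X₁ (discPoint e p q 0) + dist X₂ (discPoint e p q 0) = dist X₁ X₂)
    (h₂ : 0 < dist X₂ (discPoint e p q 0)) :
    ∃ u : ℂ, normSq u = 1 ∧ X₁ = discGeodesic e p q u (-dist X₁ (discPoint e p q 0)) ∧
      X₂ = discGeodesic e p q u (dist X₂ (discPoint e p q 0)) := by
  obtain ⟨u, hu, hX₂⟩ := exists_discGeodesic_eq e p hq X₂
  refine ⟨u, hu, ?_, hX₂⟩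
  set r₁ := dist X₁ (discPoint e p q 0)
  set r₂ := dist X₂ (discPoint e p q 0)
  have hr₁ : 0 ≤ r₁ := dist_nonneg
  apply eq_discGeodesic_of_dist_eq e p hq hu h₂.ne
  · rw [discGeodesic_zero e p, sub_zero, abs_neg, abs_of_nonneg hr₁]
  · rw [← hX₂, ← h, ← abs_neg, abs_of_nonneg] <;> linarith

end Geodesic

/-! ### The Euler–Lagrange equations in explicit form -/

/-- The hyperbolic cosine of the distance of two points of the upper half-plane. -/
def coshDist (z w : ℂ) : ℝ := 1 + normSq (z - w) / (2 * z.im * w.im)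

/-- The hyperbolic sine of the distance of two points of the upper half-plane. -/
def sinhDist (z w : ℂ) : ℝ := Real.sqrt (coshDist z w ^ 2 - 1)

/-- The acceleration, in the coordinate `z`, of a particle at `z` with velocity `v` which is
attracted by a mass `m` at `w`. -/
def acceleration (k m : ℝ) (z w v : ℂ) : ℂ :=
  -((z.im⁻¹ : ℝ) * (I * v ^ 2)) +
    (k * m / (2 * w.im * sinhDist z w ^ 3) : ℝ) * (I * ((z - w) * (z - conj w)))

theorem coshDist_comm (z w : ℂ) : coshDist z w = coshDist w z := by
  rw [coshDist, coshDist, ← normSq_neg (z - w), neg_sub, mul_right_comm]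

theorem sinhDist_comm (z w : ℂ) : sinhDist z w = sinhDist w z := by
  rw [sinhDist, sinhDist, coshDist_comm]

theorem one_lt_coshDist {z w : ℂ} (hz : 0 < z.im) (hw : 0 < w.im) (h : z ≠ w) :
    1 < coshDist z w := by
  have : 0 < normSq (z - w) := normSq_pos.2 (sub_ne_zero.2 h)
  rw [coshDist, lt_add_iff_pos_right]
  positivity

theorem sinhDist_pos {z w : ℂ} (hz : 0 < z.im) (hw : 0 < w.im) (h : z ≠ w) :
    0 < sinhDist z w := by
  have := one_lt_coshDist hz hw h
  exact Real.sqrt_pos.2 (by nlinarith)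

theorem sinhDist_eq_sinh {z w : ℂ} {d : ℝ} (hd : 0 ≤ d) (h : coshDist z w = Real.cosh d) :
    sinhDist z w = Real.sinh d := by
  rw [sinhDist, h, Real.cosh_sq, add_sub_cancel_right, Real.sqrt_sq (Real.sinh_nonneg_iff.2 hd)]

theorem cosh_dist_ofComplex {z w : ℂ} (hz : 0 < z.im) (hw : 0 < w.im) :
    Real.cosh (dist (UpperHalfPlane.ofComplex z) (UpperHalfPlane.ofComplex w)) = coshDist z w := by
  rw [UpperHalfPlane.cosh_dist, Complex.dist_eq, Complex.sq_norm,
    UpperHalfPlane.ofComplex_apply_of_im_pos hz, UpperHalfPlane.ofComplex_apply_of_im_pos hw]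
  rfl

/-- Replaces `dist` by an algebraic expression in the coordinates, which can be differentiated away
from collisions. -/
theorem lagrangian_eq (k m₁ m₂ : ℝ) {z : ℂ × ℂ} (h₁ : 0 < z.1.im) (h₂ : 0 < z.2.im) (v : ℂ × ℂ) :
    lagrangian k m₁ m₂ z v =
      (m₁ * metricInner z.1 v.1 v.1 + m₂ * metricInner z.2 v.2 v.2) / 2 +
        k * m₁ * m₂ * (coshDist z.1 z.2 / sinhDist z.1 z.2) := by
  have h := cosh_dist_ofComplex h₁ h₂
  rw [lagrangian, potential, sinhDist_eq_sinh dist_nonneg h.symm, h, sub_neg_eq_add]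

/-- The covector on `ℂ × ℂ` which is dual to a vector for the euclidean inner product. -/
def covector : ℂ × ℂ →L[ℝ] (ℂ × ℂ →L[ℝ] ℝ) :=
  LinearMap.toContinuousLinearMap
    { toFun := fun a => a.1.re • reCLM.comp (ContinuousLinearMap.fst ℝ ℂ ℂ) +
        a.1.im • imCLM.comp (ContinuousLinearMap.fst ℝ ℂ ℂ) +
        a.2.re • reCLM.comp (ContinuousLinearMap.snd ℝ ℂ ℂ) +
        a.2.im • imCLM.comp (ContinuousLinearMap.snd ℝ ℂ ℂ)
      map_add' := fun a b => by
        refine ContinuousLinearMap.ext fun h => ?_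
        simp
        ring
      map_smul' := fun c a => by
        refine ContinuousLinearMap.ext fun h => ?_
        simp
        ring }

theorem covector_apply (a h : ℂ × ℂ) :
    covector a h = a.1.re * h.1.re + a.1.im * h.1.im + a.2.re * h.2.re + a.2.im * h.2.im := by
  simp [covector]

theorem covector_injective : Function.Injective covector := by
  intro a b h
  have h' : ∀ x, covector a x = covector b x := fun x => by rw [h]
  simp only [covector_apply] at h'
  have h1 := h' (1, 0)
  have h2 := h' (I, 0)
  have h3 := h' (0, 1)
  have h4 := h' (0, I)
  simp at h1 h2 h3 h4
  exact Prod.ext (Complex.ext h1 h2) (Complex.ext h3 h4)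

/-- The conjugate momenta. -/
def momentum (m₁ m₂ : ℝ) (z v : ℂ × ℂ) : ℂ × ℂ :=
  (((m₁ / z.1.im ^ 2 : ℝ) : ℂ) * v.1, ((m₂ / z.2.im ^ 2 : ℝ) : ℂ) * v.2)

theorem fderiv_lagrangian_velocity (k m₁ m₂ : ℝ) (z v : ℂ × ℂ) :
    fderiv ℝ (fun v => lagrangian k m₁ m₂ z v) v = covector (momentum m₁ m₂ z v) := by
  have hr1 := (reCLM.comp (ContinuousLinearMap.fst ℝ ℂ ℂ)).hasFDerivAt (x := v)
  have hi1 := (imCLM.comp (ContinuousLinearMap.fst ℝ ℂ ℂ)).hasFDerivAt (x := v)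
  have hr2 := (reCLM.comp (ContinuousLinearMap.snd ℝ ℂ ℂ)).hasFDerivAt (x := v)
  have hi2 := (imCLM.comp (ContinuousLinearMap.snd ℝ ℂ ℂ)).hasFDerivAt (x := v)
  have h := ((((hr1.mul hr1).add (hi1.mul hi1)).const_mul (m₁ / z.1.im ^ 2 / 2)).add
    (((hr2.mul hr2).add (hi2.mul hi2)).const_mul (m₂ / z.2.im ^ 2 / 2))).sub_const
      (potential k m₁ m₂ (dist (UpperHalfPlane.ofComplex z.1) (UpperHalfPlane.ofComplex z.2)))
  refine (HasFDerivAt.congr_fderiv (h.congr_of_eventuallyEq (Filter.Eventually.of_forall fun w => ?_))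
    ?_).fderiv
  · simp [lagrangian, metricInner]
    ring
  · refine ContinuousLinearMap.ext fun x => ?_
    simp only [covector_apply, momentum, re_ofReal_mul, im_ofReal_mul]
    simp
    ring

/-- The gradient of `coshDist` in its first argument. -/
def gradCoshDist (z w : ℂ) : ℂ :=
  ((z.im * w.im)⁻¹ : ℝ) * (z - w) - (normSq (z - w) / (2 * z.im ^ 2 * w.im) : ℝ) * I

theorem hasFDerivAt_coshDist {z : ℂ × ℂ} (h₁ : z.1.im ≠ 0) (h₂ : z.2.im ≠ 0) :
    HasFDerivAt (fun z : ℂ × ℂ => coshDist z.1 z.2)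
      (covector (gradCoshDist z.1 z.2, gradCoshDist z.2 z.1)) z := by
  have hr1 := (reCLM.comp (ContinuousLinearMap.fst ℝ ℂ ℂ)).hasFDerivAt (x := z)
  have hi1 := (imCLM.comp (ContinuousLinearMap.fst ℝ ℂ ℂ)).hasFDerivAt (x := z)
  have hr2 := (reCLM.comp (ContinuousLinearMap.snd ℝ ℂ ℂ)).hasFDerivAt (x := z)
  have hi2 := (imCLM.comp (ContinuousLinearMap.snd ℝ ℂ ℂ)).hasFDerivAt (x := z)
  have hinv := (hasDerivAt_inv (x := 2 * z.1.im * z.2.im) (by simp [h₁, h₂])).comp_hasFDerivAt z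
    ((hi1.const_mul 2).mul hi2)
  have hN := ((hr1.sub hr2).mul (hr1.sub hr2)).add ((hi1.sub hi2).mul (hi1.sub hi2))
  have h := (hN.mul hinv).const_add 1
  refine HasFDerivAt.congr_fderiv (h.congr_of_eventuallyEq
    (Filter.Eventually.of_forall fun w => ?_)) ?_
  · simp [coshDist, normSq_apply, div_eq_mul_inv]
  · refine ContinuousLinearMap.ext fun x => ?_
    simp only [covector_apply, gradCoshDist, normSq_apply, re_ofReal_mul, im_ofReal_mul, sub_re,
      sub_im, I_re, I_im]
    simp
    field_simp
    ring

/-- This is `coth d` as a function of `D = cosh d`: the derivative `-1 / sinh² d` is divided by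
`dD/dd = sinh d`. -/
theorem hasDerivAt_div_sqrt {D : ℝ} (hD : 1 < D) :
    HasDerivAt (fun D : ℝ => D / Real.sqrt (D ^ 2 - 1)) (-(Real.sqrt (D ^ 2 - 1) ^ 3)⁻¹) D := by
  have hp : 0 < D ^ 2 - 1 := by nlinarith
  have hs : 0 < Real.sqrt (D ^ 2 - 1) := Real.sqrt_pos.2 hp
  have h := (hasDerivAt_id D).div ((((hasDerivAt_id D).pow 2).sub_const 1).sqrt hp.ne') hs.ne'
  refine h.congr_deriv ?_
  have hsq : Real.sqrt (D ^ 2 - 1) ^ 2 = D ^ 2 - 1 := Real.sq_sqrt hp.le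
  simp only [id, Pi.pow_apply]
  field_simp
  simp
  linear_combination 2 * hsq

/-- The gradient of the Lagrangian with respect to the positions. -/
def gradLagrangian (k m₁ m₂ : ℝ) (z v : ℂ × ℂ) : ℂ × ℂ :=
  (-((m₁ * normSq v.1 / z.1.im ^ 3 : ℝ) * I) -
      (k * m₁ * m₂ / sinhDist z.1 z.2 ^ 3 : ℝ) * gradCoshDist z.1 z.2,
    -((m₂ * normSq v.2 / z.2.im ^ 3 : ℝ) * I) -
      (k * m₁ * m₂ / sinhDist z.1 z.2 ^ 3 : ℝ) * gradCoshDist z.2 z.1)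

theorem fderiv_lagrangian_position (k m₁ m₂ : ℝ) {z : ℂ × ℂ} (h₁ : 0 < z.1.im) (h₂ : 0 < z.2.im)
    (hne : z.1 ≠ z.2) (v : ℂ × ℂ) :
    fderiv ℝ (fun z => lagrangian k m₁ m₂ z v) z = covector (gradLagrangian k m₁ m₂ z v) := by
  have hi1 := (imCLM.comp (ContinuousLinearMap.fst ℝ ℂ ℂ)).hasFDerivAt (x := z)
  have hi2 := (imCLM.comp (ContinuousLinearMap.snd ℝ ℂ ℂ)).hasFDerivAt (x := z)
  have hp : ∀ {y : ℝ}, 0 < y → HasDerivAt (fun y : ℝ => (y ^ 2)⁻¹) (-2 / y ^ 3) y := by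
    intro y hy
    refine (((hasDerivAt_id y).pow 2).inv (by simp [hy.ne'])).congr_deriv ?_
    simp
    field_simp
  have hg := (hasDerivAt_div_sqrt (one_lt_coshDist h₁ h₂ hne)).comp_hasFDerivAt z
    (hasFDerivAt_coshDist h₁.ne' h₂.ne')
  have h := ((((hp h₁).comp_hasFDerivAt z hi1).const_mul (m₁ * normSq v.1 / 2)).add
    (((hp h₂).comp_hasFDerivAt z hi2).const_mul (m₂ * normSq v.2 / 2))).add
      (hg.const_mul (k * m₁ * m₂))
  have ho : ∀ᶠ w : ℂ × ℂ in nhds z, 0 < w.1.im ∧ 0 < w.2.im :=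
    ((isOpen_lt continuous_const (by fun_prop : Continuous fun w : ℂ × ℂ => w.1.im)).inter
      (isOpen_lt continuous_const (by fun_prop : Continuous fun w : ℂ × ℂ => w.2.im))).mem_nhds
        ⟨h₁, h₂⟩
  refine (HasFDerivAt.congr_fderiv (h.congr_of_eventuallyEq (ho.mono fun w hw => ?_)) ?_).fderiv
  · rw [lagrangian_eq k m₁ m₂ hw.1 hw.2]
    simp [metricInner, normSq_apply, sinhDist]
    ring
  · refine ContinuousLinearMap.ext fun x => ?_
    simp only [covector_apply, gradLagrangian, re_ofReal_mul, im_ofReal_mul, sub_re,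
      sub_im, neg_re, neg_im, I_re, I_im]
    simp [covector_apply, sinhDist]
    field_simp
    ring

/-- The defect in the Euler–Lagrange equation is the defect in `a = acceleration`, scaled by the
conformal factor `m / y²`, so for `m ≠ 0` the two vanish together. -/
theorem momentum_rate_sub_grad (k m m' : ℝ) {z w : ℂ} (hz : 0 < z.im) (hw : 0 < w.im)
    (hne : z ≠ w) (v a : ℂ) :
    (m * (-2 / z.im ^ 3 * v.im) : ℝ) * v + (m / z.im ^ 2 : ℝ) * a -
        (-((m * normSq v / z.im ^ 3 : ℝ) * I) -
          (k * m * m' / sinhDist z w ^ 3 : ℝ) * gradCoshDist z w) =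
      (m / z.im ^ 2 : ℝ) * (a - acceleration k m' z w v) := by
  have hS := sinhDist_pos hz hw hne
  apply Complex.ext
  · simp only [acceleration, gradCoshDist, sub_re, sub_im, neg_re, neg_im, add_re, add_im, I_re,
      I_im, mul_re, mul_im, pow_two, conj_re, conj_im, normSq_apply, ofReal_re, ofReal_im]
    field_simp
    ring
  · simp only [acceleration, gradCoshDist, sub_re, sub_im, neg_re, neg_im, add_re, add_im, I_re,
      I_im, mul_re, mul_im, pow_two, conj_re, conj_im, normSq_apply, ofReal_re, ofReal_im]
    field_simp
    ring

theorem hasDerivAt_fst {f : ℝ → ℂ × ℂ} {f' : ℂ × ℂ} {t : ℝ} (h : HasDerivAt f f' t) :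
    HasDerivAt (fun s => (f s).1) f'.1 t :=
  (ContinuousLinearMap.fst ℝ ℂ ℂ).hasFDerivAt.comp_hasDerivAt t h

theorem hasDerivAt_snd {f : ℝ → ℂ × ℂ} {f' : ℂ × ℂ} {t : ℝ} (h : HasDerivAt f f' t) :
    HasDerivAt (fun s => (f s).2) f'.2 t :=
  (ContinuousLinearMap.snd ℝ ℂ ℂ).hasFDerivAt.comp_hasDerivAt t h

theorem hasDerivAt_div_im_sq_mul (m : ℝ) {z v : ℝ → ℂ} {a : ℂ} {t : ℝ} (hz : HasDerivAt z (v t) t)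
    (hv : HasDerivAt v a t) (him : (z t).im ≠ 0) :
    HasDerivAt (fun s => ((m / (z s).im ^ 2 : ℝ) : ℂ) * v s)
      ((m * (-2 / (z t).im ^ 3 * (v t).im) : ℝ) * v t + (m / (z t).im ^ 2 : ℝ) * a) t := by
  have h1 : HasDerivAt (fun s => (z s).im) (v t).im t := imCLM.hasFDerivAt.comp_hasDerivAt t hz
  have h2 := ((h1.pow 2).inv (pow_ne_zero 2 him)).const_mul m
  have h3 := (h2.ofReal_comp.mul hv)
  refine (h3.congr_deriv ?_).congr_of_eventuallyEq (Filter.Eventually.of_forall fun s => ?_)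
  · congr 3
    simp only [Pi.pow_apply, Nat.cast_ofNat, Nat.add_one_sub_one, pow_one]
    field_simp
  · simp [div_eq_mul_inv]

theorem eulerLagrange_lagrangian_iff (k : ℝ) {m₁ m₂ : ℝ} (hm₁ : m₁ ≠ 0) (hm₂ : m₂ ≠ 0)
    {γ : ℝ → ℂ × ℂ} (hγ : ContDiff ℝ 2 γ) (h₁ : ∀ t, 0 < (γ t).1.im) (h₂ : ∀ t, 0 < (γ t).2.im)
    (hne : ∀ t, (γ t).1 ≠ (γ t).2) :
    EulerLagrange (lagrangian k m₁ m₂) γ ↔ ∀ t, deriv (deriv γ) t =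
      (acceleration k m₂ (γ t).1 (γ t).2 (deriv γ t).1,
        acceleration k m₁ (γ t).2 (γ t).1 (deriv γ t).2) := by
  refine forall_congr' fun t => ?_
  have hd : HasDerivAt γ (deriv γ t) t := (hγ.differentiable (by norm_num) t).hasDerivAt
  have hdd : HasDerivAt (deriv γ) (deriv (deriv γ) t) t := by
    have : ContDiff ℝ 1 (deriv γ) := ((contDiff_succ_iff_deriv (n := 1)).1 hγ).2.2
    exact (this.differentiable (by norm_num) t).hasDerivAt
  have e1 := hasDerivAt_div_im_sq_mul m₁ (z := fun s => (γ s).1) (v := fun s => (deriv γ s).1)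
    (hasDerivAt_fst hd) (hasDerivAt_fst hdd) (h₁ t).ne'
  have e2 := hasDerivAt_div_im_sq_mul m₂ (z := fun s => (γ s).2) (v := fun s => (deriv γ s).2)
    (hasDerivAt_snd hd) (hasDerivAt_snd hdd) (h₂ t).ne'
  have hP := covector.hasFDerivAt.comp_hasDerivAt t (e1.prodMk e2)
  simp only [fderiv_lagrangian_velocity,
    fderiv_lagrangian_position k m₁ m₂ (h₁ t) (h₂ t) (hne t)]
  have a1 := momentum_rate_sub_grad k m₁ m₂ (h₁ t) (h₂ t) (hne t) (deriv γ t).1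
    (deriv (deriv γ) t).1
  have a2 := momentum_rate_sub_grad k m₂ m₁ (h₂ t) (h₁ t) (hne t).symm (deriv γ t).2
    (deriv (deriv γ) t).2
  -- Swapping the particles changes the order of the masses and of the points; both are restored to
  -- the order used in `gradLagrangian`.
  rw [sinhDist_comm, mul_right_comm k] at a2
  have c1 : ((m₁ / (γ t).1.im ^ 2 : ℝ) : ℂ) ≠ 0 := by
    have := (h₁ t).ne'
    exact_mod_cast div_ne_zero hm₁ (pow_ne_zero 2 this)
  have c2 : ((m₂ / (γ t).2.im ^ 2 : ℝ) : ℂ) ≠ 0 := by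
    have := (h₂ t).ne'
    exact_mod_cast div_ne_zero hm₂ (pow_ne_zero 2 this)
  constructor
  · intro h
    have h' := covector_injective (h.unique hP)
    have h1 := congrArg Prod.fst h'
    have h2 := congrArg Prod.snd h'
    rw [eq_comm] at h1 h2
    refine Prod.ext ?_ ?_
    · exact sub_eq_zero.1 ((mul_eq_zero_iff_left c1).1 (a1.symm.trans (sub_eq_zero.2 h1)))
    · exact sub_eq_zero.1 ((mul_eq_zero_iff_left c2).1 (a2.symm.trans (sub_eq_zero.2 h2)))
  · intro h
    refine hP.congr_deriv (congrArg covector (Prod.ext ?_ ?_))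
    · refine sub_eq_zero.1 (a1.trans ?_)
      rw [h, sub_self, mul_zero]
    · refine sub_eq_zero.1 (a2.trans ?_)
      rw [h, sub_self, mul_zero]

/-! ### Uniqueness of motions -/

/-- The set of times where the solutions agree is closed by continuity and open by local uniqueness,
hence all of `ℝ`. Regularity of `F` is needed only along `f`, which suits a field singular at
collisions. -/
theorem eq_of_hasDerivAt_of_contDiffAt {E : Type*} [NormedAddCommGroup E] [NormedSpace ℝ E]
    {F : E → E} {f g : ℝ → E} (hf : ∀ t, HasDerivAt f (F (f t)) t)
    (hg : ∀ t, HasDerivAt g (F (g t)) t) (hF : ∀ t, ContDiffAt ℝ 1 F (f t)) {t₀ : ℝ}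
    (h0 : f t₀ = g t₀) : f = g := by
  have hfc : Continuous f := continuous_iff_continuousAt.2 fun t => (hf t).continuousAt
  have hgc : Continuous g := continuous_iff_continuousAt.2 fun t => (hg t).continuousAt
  have hopen : IsOpen {t | f t = g t} := by
    refine isOpen_iff_mem_nhds.2 fun t (ht : f t = g t) => ?_
    obtain ⟨K, s, hs, hK⟩ := (hF t).exists_lipschitzOnWith
    exact ODE_solution_unique_of_eventually (v := fun _ => F) (s := fun _ => s) (K := K)
      (Filter.Eventually.of_forall fun _ => hK)
      ((hfc.continuousAt.eventually_mem hs).mono fun x hx => ⟨hf x, hx⟩)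
      ((hgc.continuousAt.eventually_mem (ht ▸ hs)).mono fun x hx => ⟨hg x, hx⟩) ht
  have huniv := IsClopen.eq_univ ⟨isClosed_eq hfc hgc, hopen⟩ ⟨t₀, h0⟩
  exact funext fun t => (huniv ▸ Set.mem_univ t : t ∈ {t | f t = g t})

theorem contDiffAt_acceleration {E : Type*} [NormedAddCommGroup E] [NormedSpace ℝ E] (k m : ℝ)
    {z w v : E → ℂ} {x : E} (hz : ContDiffAt ℝ 1 z x) (hw : ContDiffAt ℝ 1 w x)
    (hv : ContDiffAt ℝ 1 v x) (hz0 : 0 < (z x).im) (hw0 : 0 < (w x).im) (hne : z x ≠ w x) :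
    ContDiffAt ℝ 1 (fun y => acceleration k m (z y) (w y) (v y)) x := by
  have im_comp : ∀ {f : E → ℂ}, ContDiffAt ℝ 1 f x → ContDiffAt ℝ 1 (fun y => (f y).im) x :=
    fun hf => imCLM.contDiff.contDiffAt.comp x hf
  have re_comp : ∀ {f : E → ℂ}, ContDiffAt ℝ 1 f x → ContDiffAt ℝ 1 (fun y => (f y).re) x :=
    fun hf => reCLM.contDiff.contDiffAt.comp x hf
  have of_comp : ∀ {f : E → ℝ}, ContDiffAt ℝ 1 f x → ContDiffAt ℝ 1 (fun y => (f y : ℂ)) x :=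
    fun hf => ofRealCLM.contDiff.contDiffAt.comp x hf
  have conj_comp : ∀ {f : E → ℂ}, ContDiffAt ℝ 1 f x → ContDiffAt ℝ 1 (fun y => conj (f y)) x :=
    fun hf => conjCLE.contDiff.contDiffAt.comp x hf
  have hD : ContDiffAt ℝ 1 (fun y => coshDist (z y) (w y)) x := by
    simp only [coshDist, normSq_apply]
    have hs := hz.sub hw
    exact contDiffAt_const.add ((((re_comp hs).mul (re_comp hs)).add
      ((im_comp hs).mul (im_comp hs))).div ((contDiffAt_const.mul (im_comp hz)).mul (im_comp hw))
        (by positivity))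
  have hS : ContDiffAt ℝ 1 (fun y => sinhDist (z y) (w y)) x := by
    have := one_lt_coshDist hz0 hw0 hne
    exact ((hD.pow 2).sub contDiffAt_const).sqrt (by nlinarith)
  have hS0 := sinhDist_pos hz0 hw0 hne
  simp only [acceleration]
  exact (((of_comp ((im_comp hz).inv hz0.ne')).mul (contDiffAt_const.mul (hv.pow 2))).neg).add
    ((of_comp (contDiffAt_const.div ((contDiffAt_const.mul (im_comp hw)).mul (hS.pow 3))
      (by positivity))).mul (contDiffAt_const.mul ((hz.sub hw).mul (hz.sub (conj_comp hw)))))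

section Motion

variable {M : Type*} [MetricSpace M] (e : M ≃ᵢ UpperHalfPlane) (k : ℝ) {m₁ m₂ : ℝ}
  (hm₁ : m₁ ≠ 0) (hm₂ : m₂ ≠ 0)
include hm₁ hm₂

theorem isMotion_iff {q₁ q₂ : ℝ → M} (hne : ∀ t, q₁ t ≠ q₂ t)
    (hC : ContDiff ℝ 2 (fun t => (coord e (q₁ t), coord e (q₂ t)))) :
    IsMotion e k m₁ m₂ q₁ q₂ ↔ ∀ t,
      deriv (velocity e q₁) t =
        acceleration k m₂ (coord e (q₁ t)) (coord e (q₂ t)) (velocity e q₁ t) ∧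
      deriv (velocity e q₂) t =
        acceleration k m₁ (coord e (q₂ t)) (coord e (q₁ t)) (velocity e q₂ t) := by
  have hEL := eulerLagrange_lagrangian_iff k hm₁ hm₂ hC (fun t => coord_im_pos e (q₁ t))
    (fun t => coord_im_pos e (q₂ t)) (fun t => (coord_injective e).ne (hne t))
  have hd : deriv (fun t => (coord e (q₁ t), coord e (q₂ t))) =
      fun t => (velocity e q₁ t, velocity e q₂ t) := by
    funext t
    have h := (hC.differentiable (by norm_num) t).hasDerivAt
    exact (Prod.ext (hasDerivAt_fst h).deriv (hasDerivAt_snd h).deriv).symm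
  have hdd : ∀ t, deriv (fun t => (velocity e q₁ t, velocity e q₂ t)) t =
      (deriv (velocity e q₁) t, deriv (velocity e q₂) t) := by
    intro t
    have h1 : ContDiff ℝ 1 (fun t => (velocity e q₁ t, velocity e q₂ t)) :=
      hd ▸ ((contDiff_succ_iff_deriv (n := 1)).1 hC).2.2
    have h := (h1.differentiable (by norm_num) t).hasDerivAt
    exact (Prod.ext (hasDerivAt_fst h).deriv (hasDerivAt_snd h).deriv).symm
  rw [hd] at hEL
  simp only [hdd, Prod.mk.injEq] at hEL
  exact ⟨fun h => hEL.1 h.eulerLagrange, fun h => ⟨hne, hC, hEL.2 h⟩⟩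

theorem IsMotion.hasDerivAt_state {q₁ q₂ : ℝ → M} (h : IsMotion e k m₁ m₂ q₁ q₂) (t : ℝ) :
    HasDerivAt (fun t => ((coord e (q₁ t), coord e (q₂ t)), (velocity e q₁ t, velocity e q₂ t)))
      ((velocity e q₁ t, velocity e q₂ t),
        (acceleration k m₂ (coord e (q₁ t)) (coord e (q₂ t)) (velocity e q₁ t),
          acceleration k m₁ (coord e (q₂ t)) (coord e (q₁ t)) (velocity e q₂ t))) t := by
  have hd : deriv (fun t => (coord e (q₁ t), coord e (q₂ t))) =
      fun t => (velocity e q₁ t, velocity e q₂ t) := by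
    funext t
    have h := (h.contDiff.differentiable (by norm_num) t).hasDerivAt
    exact (Prod.ext (hasDerivAt_fst h).deriv (hasDerivAt_snd h).deriv).symm
  have h0 := (h.contDiff.differentiable (by norm_num) t).hasDerivAt
  have h1 : ContDiff ℝ 1 (fun t => (velocity e q₁ t, velocity e q₂ t)) :=
    hd ▸ ((contDiff_succ_iff_deriv (n := 1)).1 h.contDiff).2.2
  have h2 := (h1.differentiable (by norm_num) t).hasDerivAt
  rw [congrFun hd t] at h0
  have hacc := (isMotion_iff e k hm₁ hm₂ h.ne h.contDiff).1 h t
  rw [← hacc.1, ← hacc.2]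
  exact h0.prodMk (h2.congr_deriv
    (Prod.ext (hasDerivAt_fst h2).deriv (hasDerivAt_snd h2).deriv).symm)

/-- A motion is determined by its initial positions and velocities. -/
theorem IsMotion.eq_of_initial {q₁ q₂ p₁ p₂ : ℝ → M} (hq : IsMotion e k m₁ m₂ q₁ q₂)
    (hp : IsMotion e k m₁ m₂ p₁ p₂) (h₁ : p₁ 0 = q₁ 0) (h₂ : p₂ 0 = q₂ 0)
    (hv₁ : velocity e p₁ 0 = velocity e q₁ 0) (hv₂ : velocity e p₂ 0 = velocity e q₂ 0) :
    p₁ = q₁ ∧ p₂ = q₂ := by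
  have h := eq_of_hasDerivAt_of_contDiffAt (t₀ := 0)
    (F := fun x : (ℂ × ℂ) × (ℂ × ℂ) => (x.2,
      (acceleration k m₂ x.1.1 x.1.2 x.2.1, acceleration k m₁ x.1.2 x.1.1 x.2.2)))
    (hp.hasDerivAt_state e k hm₁ hm₂) (hq.hasDerivAt_state e k hm₁ hm₂)
    (fun t => by
      have hne := (coord_injective e).ne (hp.ne t)
      have h1 := coord_im_pos e (p₁ t)
      have h2 := coord_im_pos e (p₂ t)
      exact contDiffAt_snd.prodMk
        ((contDiffAt_acceleration k m₂ contDiffAt_fst.fst contDiffAt_fst.snd contDiffAt_snd.fst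
          h1 h2 hne).prodMk
        (contDiffAt_acceleration k m₁ contDiffAt_fst.snd contDiffAt_fst.fst contDiffAt_snd.snd
          h2 h1 hne.symm)))
    (by rw [h₁, h₂, hv₁, hv₂])
  have h' := fun t => congrArg Prod.fst (congrFun h t)
  exact ⟨funext fun t => coord_injective e (congrArg Prod.fst (h' t)),
    funext fun t => coord_injective e (congrArg Prod.snd (h' t))⟩

end Motion

/-! ### Tangent vectors in disc coordinates -/

/-- The derivative of `discMap`. -/
def discDeriv (q : ℝ) (w : ℂ) : ℂ := 2 * I * q / (1 - w) ^ 2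

theorem hasDerivAt_discMap (p q : ℝ) {w : ℂ} (hw : 1 - w ≠ 0) :
    HasDerivAt (discMap p q) (discDeriv q w) w := by
  have h := ((((((hasDerivAt_id w).const_add 1).div ((hasDerivAt_id w).const_sub 1) hw).const_mul
    I).const_mul (q : ℂ)).const_add (p : ℂ))
  refine h.congr_deriv ?_
  simp only [discDeriv, id]
  field_simp
  ring

/-- The pulled-back metric is the Poincaré metric `4 |dw|² / (1 - |w|²)²`. -/
theorem normSq_discDeriv (p : ℝ) {q : ℝ} (hq : 0 < q) {w : ℂ} (hw : normSq w < 1) :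
    normSq (discDeriv q w) / (discMap p q w).im ^ 2 = 4 / (1 - normSq w) ^ 2 := by
  have h1 := normSq_pos.2 (one_sub_ne_zero_of_normSq_lt hw)
  have h3 : 1 - normSq w ≠ 0 := by linarith
  rw [discMap_im, discDeriv]
  simp only [normSq_div, normSq_mul, normSq_I, normSq_ofReal, normSq_ofNat, map_pow]
  field_simp
  norm_num

theorem discDeriv_ne_zero {q : ℝ} (hq : 0 < q) {w : ℂ} (hw : normSq w < 1) :
    discDeriv q w ≠ 0 := by
  have h1 := one_sub_ne_zero_of_normSq_lt hw
  have hq' : (q : ℂ) ≠ 0 := by exact_mod_cast hq.ne'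
  simp [discDeriv, h1, hq']

theorem metricInner_eq (z v w : ℂ) : metricInner z v w = (v * conj w).re / z.im ^ 2 := by
  simp [metricInner]

theorem orient_eq (v w : ℂ) : orient v w = -(v * conj w).im := by
  simp [orient]; ring

theorem metricInner_discDeriv (p : ℝ) {q : ℝ} (hq : 0 < q) {w : ℂ} (hw : normSq w < 1)
    (α β : ℂ) : metricInner (discMap p q w) (discDeriv q w * α) (discDeriv q w * β) =
      4 / (1 - normSq w) ^ 2 * (α * conj β).re := by
  rw [metricInner_eq, map_mul, mul_mul_mul_comm, mul_conj, re_ofReal_mul, mul_div_right_comm,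
    normSq_discDeriv p hq hw]

theorem orient_discDeriv (q : ℝ) (w α β : ℂ) :
    orient (discDeriv q w * α) (discDeriv q w * β) =
      -(normSq (discDeriv q w) * (α * conj β).im) := by
  rw [orient_eq, map_mul, mul_mul_mul_comm, mul_conj, im_ofReal_mul]

theorem metricNorm_discDeriv (p : ℝ) {q : ℝ} (hq : 0 < q) {w : ℂ} (hw : normSq w < 1) (α : ℂ) :
    metricNorm (discMap p q w) (discDeriv q w * α) = 2 * ‖α‖ / (1 - normSq w) := by
  have h3 : 0 < 1 - normSq w := by linarith
  rw [metricNorm, metricInner_discDeriv p hq hw, mul_conj, ofReal_re, ← Complex.sq_norm α]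
  rw [show 4 / (1 - normSq w) ^ 2 * ‖α‖ ^ 2 = (2 * ‖α‖ / (1 - normSq w)) ^ 2 by field_simp; ring]
  exact Real.sqrt_sq (by positivity)

section Velocity

variable {M : Type*} [MetricSpace M] (e : M ≃ᵢ UpperHalfPlane) (p : ℝ) {q : ℝ} (hq : 0 < q)
include hq

theorem hasDerivAt_coord_discPoint {w : ℝ → ℂ} {w' : ℂ} {t : ℝ} (hw : ∀ s, normSq (w s) < 1)
    (h : HasDerivAt w w' t) :
    HasDerivAt (fun s => coord e (discPoint e p q (w s))) (discDeriv q (w t) * w') t := by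
  have h1 := (hasDerivAt_discMap p q (one_sub_ne_zero_of_normSq_lt (hw t))).comp t h
  exact h1.congr_of_eventuallyEq
    (Filter.Eventually.of_forall fun s => coord_discPoint e p hq (hw s))

theorem velocity_discPoint {w : ℝ → ℂ} {w' : ℂ} {t : ℝ} (hw : ∀ s, normSq (w s) < 1)
    (h : HasDerivAt w w' t) :
    velocity e (fun s => discPoint e p q (w s)) t = discDeriv q (w t) * w' :=
  (hasDerivAt_coord_discPoint e p hq hw h).deriv

omit hq in
theorem hasDerivAt_tanh_half (s : ℝ) :
    HasDerivAt (fun s => Real.tanh (s / 2)) ((1 - Real.tanh (s / 2) ^ 2) / 2) s := by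
  have hc := (Real.cosh_pos (s / 2)).ne'
  have h2 : HasDerivAt (fun s : ℝ => s / 2) (1 / 2) s := (hasDerivAt_id s).div_const 2
  have h := h2.sinh.fun_div h2.cosh hc
  refine (h.congr_deriv ?_).congr_of_eventuallyEq
    (Filter.Eventually.of_forall fun x => Real.tanh_eq_sinh_div_cosh _)
  simp only [Real.tanh_eq_sinh_div_cosh]
  field_simp

theorem velocity_discGeodesic_affine {u : ℂ} (hu : normSq u = 1) (ε s₁ r s : ℝ) :
    velocity e (fun s => discGeodesic e p q u (ε * (s - s₁) + r)) s =
      discDeriv q ((Real.tanh ((ε * (s - s₁) + r) / 2) : ℝ) * u) *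
        (((1 - Real.tanh ((ε * (s - s₁) + r) / 2) ^ 2) / 2 * ε : ℝ) * u) := by
  have h1 : HasDerivAt (fun s => ε * (s - s₁) + r) ε s := by
    simpa using (((hasDerivAt_id s).sub_const s₁).const_mul ε).add_const r
  have h2 := ((hasDerivAt_tanh_half _).comp s h1).ofReal_comp.mul_const u
  exact velocity_discPoint e p hq (fun s => normSq_tanh_mul_unit _ hu) h2

/-- The disc coordinate is conformal and the diameter has direction `u` at both points, so angles
and orientations may be measured against `u` itself. By uniqueness of the geodesic, the
parametrizations differ only by a shift and a sign `ε`, which does not affect the conditions. -/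
theorem perpOpposite_iff {u : ℂ} (hu : normSq u = 1) {r₁ r₂ : ℝ} (hr : r₁ ≠ r₂) (α₁ α₂ : ℂ) :
    PerpOpposite e (discGeodesic e p q u r₁) (discGeodesic e p q u r₂)
        (discDeriv q ((Real.tanh (r₁ / 2) : ℝ) * u) * α₁)
        (discDeriv q ((Real.tanh (r₂ / 2) : ℝ) * u) * α₂) ↔
      (α₁ * conj u).re = 0 ∧ (α₂ * conj u).re = 0 ∧
        (α₁ * conj u).im * (α₂ * conj u).im < 0 := by
  have hw := fun r => normSq_tanh_mul_unit r hu
  have key : ∀ ε : ℝ, (ε = 1 ∨ ε = -1) → ∀ (α : ℂ) (r : ℝ),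
      ∃ c c' : ℝ, c ≠ 0 ∧ 0 < c' * ε ∧
      metricInner (coord e (discGeodesic e p q u r)) (discDeriv q ((Real.tanh (r / 2) : ℝ) * u) * α)
        (discDeriv q ((Real.tanh (r / 2) : ℝ) * u) *
          (((1 - Real.tanh (r / 2) ^ 2) / 2 * ε : ℝ) * u)) = c * (α * conj u).re ∧
      orient (discDeriv q ((Real.tanh (r / 2) : ℝ) * u) * α)
        (discDeriv q ((Real.tanh (r / 2) : ℝ) * u) *
          (((1 - Real.tanh (r / 2) ^ 2) / 2 * ε : ℝ) * u)) = -(c' * (α * conj u).im) := by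
    intro ε hε α r
    have h1 : 0 < 1 - normSq ((Real.tanh (r / 2) : ℝ) * u) := by linarith [hw r]
    have h2 : 0 < 1 - Real.tanh (r / 2) ^ 2 := by linarith [tanh_half_sq_lt_one r]
    have h3 := normSq_pos.2 (discDeriv_ne_zero hq (hw r))
    have hε0 : ε ≠ 0 := by rcases hε with h | h <;> simp [h]
    have hε2 : ε * ε = 1 := by rcases hε with h | h <;> simp [h]
    refine ⟨4 / (1 - normSq ((Real.tanh (r / 2) : ℝ) * u)) ^ 2 *
      ((1 - Real.tanh (r / 2) ^ 2) / 2 * ε), normSq (discDeriv q ((Real.tanh (r / 2) : ℝ) * u)) *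
      ((1 - Real.tanh (r / 2) ^ 2) / 2 * ε), by positivity, ?_, ?_, ?_⟩
    · rw [mul_assoc, mul_assoc, hε2]
      positivity
    · rw [discGeodesic, coord_discPoint e p hq (hw r), metricInner_discDeriv p hq (hw r),
        map_mul (starRingEnd ℂ), conj_ofReal, mul_left_comm α, re_ofReal_mul]
      ring
    · rw [orient_discDeriv, map_mul (starRingEnd ℂ), conj_ofReal, mul_left_comm α, im_ofReal_mul]
      ring
  have aux : ∀ ε : ℝ, (ε = 1 ∨ ε = -1) →
      ((metricInner (coord e (discGeodesic e p q u r₁))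
          (discDeriv q ((Real.tanh (r₁ / 2) : ℝ) * u) * α₁)
          (discDeriv q ((Real.tanh (r₁ / 2) : ℝ) * u) *
            (((1 - Real.tanh (r₁ / 2) ^ 2) / 2 * ε : ℝ) * u)) = 0 ∧
        metricInner (coord e (discGeodesic e p q u r₂))
          (discDeriv q ((Real.tanh (r₂ / 2) : ℝ) * u) * α₂)
          (discDeriv q ((Real.tanh (r₂ / 2) : ℝ) * u) *
            (((1 - Real.tanh (r₂ / 2) ^ 2) / 2 * ε : ℝ) * u)) = 0 ∧
        orient (discDeriv q ((Real.tanh (r₁ / 2) : ℝ) * u) * α₁)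
          (discDeriv q ((Real.tanh (r₁ / 2) : ℝ) * u) *
            (((1 - Real.tanh (r₁ / 2) ^ 2) / 2 * ε : ℝ) * u)) *
        orient (discDeriv q ((Real.tanh (r₂ / 2) : ℝ) * u) * α₂)
          (discDeriv q ((Real.tanh (r₂ / 2) : ℝ) * u) *
            (((1 - Real.tanh (r₂ / 2) ^ 2) / 2 * ε : ℝ) * u)) < 0) ↔
      (α₁ * conj u).re = 0 ∧ (α₂ * conj u).re = 0 ∧
        (α₁ * conj u).im * (α₂ * conj u).im < 0) := by
    intro ε hε
    obtain ⟨c₁, c₁', h1, h2, h3, h4⟩ := key ε hε α₁ r₁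
    obtain ⟨c₂, c₂', h5, h6, h7, h8⟩ := key ε hε α₂ r₂
    -- Both orientation factors carry the sign `ε` of the parametrization, which cancels in the
    -- product.
    have hc : 0 < c₁' * c₂' := by
      have hε2 : ε * ε = 1 := by rcases hε with h | h <;> simp [h]
      have := mul_pos h2 h6
      nlinarith
    rw [h3, h4, h7, h8, mul_eq_zero, mul_eq_zero, neg_mul_neg, mul_mul_mul_comm]
    simp only [h1, h5, false_or, mul_neg_iff, hc, hc.not_gt, true_and, false_and, or_false]
  constructor
  · intro h
    have h1 := h.2 _ (isGeodesic_discGeodesic e p hq hu) r₁ r₂ rfl rfl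
    have h2 := fun s => velocity_discGeodesic_affine e p hq hu 1 0 0 s
    simp only [sub_zero, add_zero, one_mul] at h2
    change ∀ s, velocity e (discGeodesic e p q u) s = _ at h2
    rw [h2, h2] at h1
    exact (aux 1 (Or.inl rfl)).1 h1
  · intro h
    refine ⟨⟨_, isGeodesic_discGeodesic e p hq hu, ⟨r₁, rfl⟩, ⟨r₂, rfl⟩⟩, ?_⟩
    intro ℓ hℓ s₁ s₂ h1 h2
    obtain ⟨ε, hε, hℓs⟩ := isGeodesic_eq_discGeodesic e p hq hu hℓ hr h1 h2
    have e1 : ε * (s₁ - s₁) + r₁ = r₁ := by simp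
    have e2 : ε * (s₂ - s₁) + r₁ = r₂ :=
      (isGeodesic_discGeodesic e p hq hu).injective ((hℓs s₂).symm.trans h2)
    have hv := velocity_discGeodesic_affine e p hq hu ε s₁ r₁
    have hv1 := hv s₁
    have hv2 := hv s₂
    rw [e1] at hv1
    rw [e2] at hv2
    rw [funext hℓs, hv1, hv2]
    exact (aux ε hε).2 h

end Velocity

/-! ### The hyperbolic center of mass -/

section CenterOfMass

variable {M : Type*} [MetricSpace M] (e : M ≃ᵢ UpperHalfPlane) (p : ℝ) {q : ℝ} (hq : 0 < q)
  {m₁ m₂ : ℝ} (hm₁ : 0 < m₁) (hm₂ : 0 < m₂)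

theorem discPoint_coord_zero (C : M) : discPoint e (coord e C).re (coord e C).im 0 = C := by
  apply coord_injective e
  rw [coord_discPoint e _ (coord_im_pos e C) (by simp)]
  simp [discMap, mul_comm I, re_add_im]

include hq

theorem dist_discGeodesic_center {u : ℂ} (hu : normSq u = 1) (r : ℝ) :
    dist (discGeodesic e p q u r) (discPoint e p q 0) = |r| := by
  rw [← discGeodesic_zero e p u, dist_discGeodesic e p hq hu, sub_zero]

theorem isCenterOfMass_discPoint_zero {u : ℂ} (hu : normSq u = 1) {r₁ r₂ : ℝ} (h₁ : 0 ≤ r₁)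
    (h₂ : 0 ≤ r₂) (h : m₁ * Real.sinh (2 * r₁) = m₂ * Real.sinh (2 * r₂)) :
    IsCenterOfMass m₁ m₂ (discGeodesic e p q u (-r₁)) (discGeodesic e p q u r₂)
      (discPoint e p q 0) := by
  refine ⟨⟨_, isGeodesic_discGeodesic e p hq hu, -r₁, 0, r₂, by linarith, h₂, rfl,
    discGeodesic_zero e p u, rfl⟩, ?_⟩
  rw [dist_discGeodesic_center e p hq hu, dist_discGeodesic_center e p hq hu, abs_neg,
    abs_of_nonneg h₁, abs_of_nonneg h₂, h]

include hm₁ hm₂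

/-- As the point moves along the segment away from the first mass, `m₁ sinh (2 d₁)` increases and
`m₂ sinh (2 d₂)` decreases, so they agree at most once. -/
theorem IsCenterOfMass.eq_discPoint_zero {u : ℂ} (hu : normSq u = 1) {r₁ r₂ : ℝ} (h₁ : 0 < r₁)
    (h₂ : 0 < r₂) (h : m₁ * Real.sinh (2 * r₁) = m₂ * Real.sinh (2 * r₂)) {C : M}
    (hC : IsCenterOfMass m₁ m₂ (discGeodesic e p q u (-r₁)) (discGeodesic e p q u r₂) C) :
    C = discPoint e p q 0 := by
  obtain ⟨⟨ℓ, hℓ, s₁, s, s₂, hs₁, hs₂, e₁, e₂, e₃⟩, hm⟩ := hC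
  have hd := dist_discGeodesic e p hq hu (-r₁) r₂
  have d₁ : dist (discGeodesic e p q u (-r₁)) C = s - s₁ := by
    rw [← e₁, ← e₂, hℓ.dist_eq, Real.dist_eq, abs_sub_comm, abs_of_nonneg (by linarith)]
  have d₂ : dist (discGeodesic e p q u r₂) C = s₂ - s := by
    rw [← e₃, ← e₂, hℓ.dist_eq, Real.dist_eq, abs_of_nonneg (by linarith)]
  rw [← e₁, ← e₃, hℓ.dist_eq, Real.dist_eq, abs_sub_comm, abs_of_nonneg (by linarith),
    abs_sub_comm, abs_of_nonneg (by linarith)] at hd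
  rw [d₁, d₂] at hm
  have hx : s - s₁ = r₁ := by
    rcases lt_trichotomy (s - s₁) r₁ with hlt | heq | hgt
    · have a1 := mul_lt_mul_of_pos_left
        (Real.sinh_lt_sinh.2 (by linarith : 2 * (s - s₁) < 2 * r₁)) hm₁
      have a2 := mul_lt_mul_of_pos_left
        (Real.sinh_lt_sinh.2 (by linarith : 2 * r₂ < 2 * (s₂ - s))) hm₂
      linarith
    · exact heq
    · have a1 := mul_lt_mul_of_pos_left
        (Real.sinh_lt_sinh.2 (by linarith : 2 * r₁ < 2 * (s - s₁))) hm₁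
      have a2 := mul_lt_mul_of_pos_left
        (Real.sinh_lt_sinh.2 (by linarith : 2 * (s₂ - s) < 2 * r₂)) hm₂
      linarith
  rw [← discGeodesic_zero e p u]
  apply eq_discGeodesic_of_dist_eq e p hq hu (s₁ := -r₁) (s₂ := r₂) (by linarith)
  · rw [dist_comm, d₁, hx, zero_sub, neg_neg, abs_of_pos h₁]
  · rw [dist_comm, d₂, zero_sub, abs_neg, abs_of_pos h₂]
    linarith

omit hq in
/-- Any two distinct points lie, on opposite sides of their center of mass, on a geodesic through
this center. -/
theorem exists_center_of_mass_coordinates {X₁ X₂ : M} (hne : X₁ ≠ X₂) :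
    ∃ (p q : ℝ) (u : ℂ) (r₁ r₂ : ℝ), 0 < q ∧ normSq u = 1 ∧ 0 < r₁ ∧ 0 < r₂ ∧
      m₁ * Real.sinh (2 * r₁) = m₂ * Real.sinh (2 * r₂) ∧
      X₁ = discGeodesic e p q u (-r₁) ∧ X₂ = discGeodesic e p q u r₂ := by
  have hd : 0 < dist X₂ X₁ := dist_pos.2 hne.symm
  set d := dist X₂ X₁ with hd_def
  obtain ⟨u, hu, hX₂⟩ := exists_discGeodesic_eq e (coord e X₁).re (coord_im_pos e X₁) X₂
  rw [discPoint_coord_zero, ← hd_def] at hX₂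
  have hX₁ : X₁ = discGeodesic e (coord e X₁).re (coord e X₁).im u 0 := by
    rw [discGeodesic_zero, discPoint_coord_zero]
  have hcont : ContinuousOn (fun r => m₁ * Real.sinh (2 * r) - m₂ * Real.sinh (2 * (d - r)))
      (Set.Icc 0 d) := by fun_prop
  have hsd : 0 < Real.sinh (2 * d) := Real.sinh_pos_iff.2 (by linarith)
  -- The difference is negative at `X₁`, where `r = 0`, and positive at `X₂`, where `r = d`; its
  -- zero is the center of mass.
  obtain ⟨r, hr, hr0⟩ := intermediate_value_Ioo hd.le hcont
    (show (0 : ℝ) ∈ _ by simp; constructor <;> positivity)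
  obtain ⟨hr1, hr2⟩ := hr
  set C := discGeodesic e (coord e X₁).re (coord e X₁).im u r with hC
  have dX₁ : dist X₁ C = r := by
    conv_lhs => rw [hX₁]
    rw [hC, dist_discGeodesic e _ (coord_im_pos e X₁) hu, zero_sub, abs_neg, abs_of_pos hr1]
  have dX₂ : dist X₂ C = d - r := by
    conv_lhs => rw [hX₂]
    rw [hC, dist_discGeodesic e _ (coord_im_pos e X₁) hu, abs_of_pos (by linarith)]
  -- So far the disc was centered at `X₁`; it is now recentered at the center of mass `C`.
  obtain ⟨u', hu', h1, h2⟩ := exists_discGeodesic_eq_of_dist_add e (coord e C).re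
    (coord_im_pos e C) (X₁ := X₁) (X₂ := X₂)
    (by rw [discPoint_coord_zero, dX₁, dX₂, dist_comm X₁ X₂]; linarith)
    (by rw [discPoint_coord_zero, dX₂]; linarith)
  rw [discPoint_coord_zero] at h1 h2
  rw [dX₁] at h1
  rw [dX₂] at h2
  exact ⟨_, _, u', r, d - r, coord_im_pos e C, hu', hr1, by linarith, sub_eq_zero.1 hr0, h1, h2⟩

end CenterOfMass

/-! ### Rotating orbits and the balance equation -/

/-- The hyperbolic sine of the distance of two points of the disc. -/
def discSinhDist (w w' : ℂ) : ℝ :=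
  Real.sqrt ((1 + 2 * normSq (w - w') / ((1 - normSq w) * (1 - normSq w'))) ^ 2 - 1)

/-- The balance between the attraction by a mass `m` at `w'` and the acceleration of a particle at
`w` which rotates about the center of the disc with angular velocity `η`. -/
def Balanced (k m η : ℝ) (w w' : ℂ) : Prop :=
  (η ^ 2 * ((1 + normSq w) / (1 - normSq w)) : ℝ) * w =
    (k * m / ((1 - normSq w') * discSinhDist w w' ^ 3) : ℝ) * ((w - w') * (1 - w * conj w'))

/-- Norms, distances and `w * conj w'` are unchanged by a common rotation, so both sides are
multiplied by `ζ`. -/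
theorem Balanced.rotate {k m η : ℝ} {w w' : ℂ} {ζ : ℂ} (hζ : normSq ζ = 1)
    (h : Balanced k m η w w') : Balanced k m η (ζ * w) (ζ * w') := by
  have hc : ζ * conj ζ = 1 := by rw [mul_conj, hζ, ofReal_one]
  have h1 : (1 : ℂ) - ζ * w * conj (ζ * w') = 1 - w * conj w' := by
    rw [map_mul]
    linear_combination (-(w * conj w')) * hc
  unfold Balanced discSinhDist at *
  rw [h1, ← mul_sub, normSq_mul, normSq_mul, normSq_mul, hζ, one_mul, one_mul, one_mul]
  linear_combination ζ * h

theorem sinhDist_discMap (p : ℝ) {q : ℝ} (hq : 0 < q) {w w' : ℂ} (hw : normSq w < 1)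
    (hw' : normSq w' < 1) : sinhDist (discMap p q w) (discMap p q w') = discSinhDist w w' := by
  have h := cosh_dist_discPoint (IsometryEquiv.refl UpperHalfPlane) p hq hw hw'
  rw [cosh_dist_eq_coord (IsometryEquiv.refl UpperHalfPlane),
    coord_discPoint _ p hq hw, coord_discPoint _ p hq hw'] at h
  rw [sinhDist, coshDist, h, discSinhDist]

theorem discSinhDist_pos {w w' : ℂ} (hw : normSq w < 1) (hw' : normSq w' < 1) (h : w ≠ w') :
    0 < discSinhDist w w' := by
  rw [← sinhDist_discMap 0 one_pos hw hw']
  exact sinhDist_pos (discMap_im_pos 0 one_pos hw) (discMap_im_pos 0 one_pos hw')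
    fun hh => h (discMap_injective 0 one_pos hw hw' hh)

theorem acceleration_discMap (k m p : ℝ) {q : ℝ} (hq : 0 < q) {w w' : ℂ} (hw : normSq w < 1)
    (hw' : normSq w' < 1) (h : w ≠ w') (α : ℂ) :
    acceleration k m (discMap p q w) (discMap p q w') (discDeriv q w * α) =
      discDeriv q w * (2 * (1 - conj w) / ((1 - w) * (1 - normSq w)) * α ^ 2 -
        (k * m / ((1 - normSq w') * discSinhDist w w' ^ 3) : ℝ) *
          ((w - w') * (1 - w * conj w'))) := by
  have hS : (discSinhDist w w' : ℂ) ≠ 0 := by exact_mod_cast (discSinhDist_pos hw hw' h).ne'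
  have hq' : (q : ℂ) ≠ 0 := by exact_mod_cast hq.ne'
  have a1 := one_sub_ne_zero_of_normSq_lt hw
  have a2 := one_sub_ne_zero_of_normSq_lt hw'
  have a3 : 1 - conj w ≠ 0 :=
    one_sub_ne_zero_of_normSq_lt (w := conj w) (by rwa [normSq_conj])
  have a4 : 1 - conj w' ≠ 0 :=
    one_sub_ne_zero_of_normSq_lt (w := conj w') (by rwa [normSq_conj])
  have b1 : (1 : ℂ) - normSq w ≠ 0 := by
    exact_mod_cast (by linarith : (1 : ℝ) - normSq w ≠ 0)
  have b2 : (1 : ℂ) - normSq w' ≠ 0 := by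
    exact_mod_cast (by linarith : (1 : ℝ) - normSq w' ≠ 0)
  have c1 : (normSq (1 - w) : ℂ) = (1 - w) * (1 - conj w) := by
    rw [← mul_conj, map_sub, map_one]
  have c2 : (normSq (1 - w') : ℂ) = (1 - w') * (1 - conj w') := by
    rw [← mul_conj, map_sub, map_one]
  rw [acceleration, discMap_sub p q hw hw', discMap_sub_conj p q hw hw', discMap_im, discMap_im,
    sinhDist_discMap p hq hw hw', discDeriv]
  push_cast
  rw [c1, c2]
  -- Once the factors `normSq (1 - w)` are split, the identity is rational with `w`, its conjugate
  -- and its norm as independent variables.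
  generalize (normSq w : ℂ) = N at *
  generalize (normSq w' : ℂ) = N' at *
  generalize conj w = v at *
  generalize conj w' = v' at *
  field_simp
  ring_nf
  simp only [I_sq]
  ring

theorem normSq_exp_ofReal_mul_I (x : ℝ) : normSq (exp (x * I)) = 1 := by
  rw [← Complex.sq_norm, norm_exp_ofReal_mul_I, one_pow]

/-- The curve which rotates about the center of the disc with angular velocity `η`. -/
def discOrbit (η : ℝ) (w : ℂ) (t : ℝ) : ℂ := exp ((-(η * t) : ℝ) * I) * w

theorem normSq_discOrbit (η : ℝ) (w : ℂ) (t : ℝ) : normSq (discOrbit η w t) = normSq w := by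
  rw [discOrbit, normSq_mul, normSq_exp_ofReal_mul_I, one_mul]

theorem discOrbit_zero (η : ℝ) (w : ℂ) : discOrbit η w 0 = w := by simp [discOrbit]

theorem discOrbit_injective (η t : ℝ) : Function.Injective fun w => discOrbit η w t :=
  mul_right_injective₀ (exp_ne_zero _)

theorem hasDerivAt_discOrbit (η : ℝ) (w : ℂ) (t : ℝ) :
    HasDerivAt (discOrbit η w) (-(I * η) * discOrbit η w t) t := by
  have h := ((((hasDerivAt_id t).const_mul η).neg.ofReal_comp.mul_const I).cexp).mul_const w
  refine h.congr_deriv ?_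
  simp [discOrbit]
  ring

theorem contDiff_discOrbit (η : ℝ) (w : ℂ) : ContDiff ℝ 2 (discOrbit η w) := by
  have h : ContDiff ℝ 2 fun t : ℝ => ((-(η * t) : ℝ) : ℂ) :=
    ofRealCLM.contDiff.comp (contDiff_const.mul contDiff_id).neg
  exact ((h.mul contDiff_const).cexp).mul contDiff_const

section Motion

variable {M : Type*} [MetricSpace M] (e : M ≃ᵢ UpperHalfPlane) (p : ℝ) {q : ℝ} (hq : 0 < q)
include hq

theorem velocity_discOrbit (η : ℝ) {w : ℂ} (hw : normSq w < 1) (t : ℝ) :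
    velocity e (fun t => discPoint e p q (discOrbit η w t)) t =
      discDeriv q (discOrbit η w t) * (-(I * η) * discOrbit η w t) :=
  velocity_discPoint e p hq (fun s => by rwa [normSq_discOrbit]) (hasDerivAt_discOrbit η w t)

theorem contDiff_coord_discOrbit (η : ℝ) {w : ℂ} (hw : normSq w < 1) :
    ContDiff ℝ 2 fun t => coord e (discPoint e p q (discOrbit η w t)) := by
  have hw' : ∀ s, normSq (discOrbit η w s) < 1 := fun s => by rwa [normSq_discOrbit]
  have h1 : (fun t => coord e (discPoint e p q (discOrbit η w t))) =
      fun t => discMap p q (discOrbit η w t) :=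
    funext fun t => coord_discPoint e p hq (hw' t)
  have h2 := contDiff_discOrbit η w
  rw [h1]
  simp only [discMap, div_eq_mul_inv]
  exact contDiff_const.add (contDiff_const.mul (contDiff_const.mul ((contDiff_const.add h2).mul
    ((contDiff_const.sub h2).inv fun t => one_sub_ne_zero_of_normSq_lt (hw' t)))))

theorem deriv_velocity_discOrbit (η : ℝ) {w : ℂ} (hw : normSq w < 1) (t : ℝ) :
    deriv (velocity e (fun t => discPoint e p q (discOrbit η w t))) t =
      discDeriv q (discOrbit η w t) * (-(η ^ 2 * discOrbit η w t *
        ((1 + discOrbit η w t) / (1 - discOrbit η w t)))) := by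
  rw [funext (velocity_discOrbit e p hq η hw)]
  have hne : 1 - discOrbit η w t ≠ 0 :=
    one_sub_ne_zero_of_normSq_lt (by rwa [normSq_discOrbit])
  have h0 := hasDerivAt_discOrbit η w t
  have h1 : HasDerivAt (fun W : ℂ => discDeriv q W * (-(I * η) * W))
      (2 * η * q * (1 + discOrbit η w t) / (1 - discOrbit η w t) ^ 3) (discOrbit η w t) := by
    have h2 := ((((hasDerivAt_id (discOrbit η w t)).const_sub 1).fun_pow 2).fun_inv
      (pow_ne_zero 2 hne)).const_mul (2 * I * (q : ℂ))
    have h3 := h2.fun_mul ((hasDerivAt_id (discOrbit η w t)).const_mul (-(I * (η : ℂ))))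
    refine h3.congr_deriv ?_
    simp only [id]
    field_simp
    ring_nf
    simp only [I_sq]
    ring
  refine ((h1.comp t h0).congr_deriv ?_).deriv
  simp only [discDeriv]
  field_simp

/-- After `discDeriv` is cancelled, the terms coming from the half-plane coordinate combine into the
covariant acceleration of circular motion, `-η² (1 + |w|²) / (1 - |w|²) w`; this is `key`. What
remains is the balance with the attraction. -/
theorem deriv_velocity_discOrbit_eq_iff (k m η : ℝ) {w w' : ℂ} (hw : normSq w < 1)
    (hw' : normSq w' < 1) (h : w ≠ w') (t : ℝ) :
    deriv (velocity e (fun t => discPoint e p q (discOrbit η w t))) t =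
        acceleration k m (coord e (discPoint e p q (discOrbit η w t)))
          (coord e (discPoint e p q (discOrbit η w' t)))
          (velocity e (fun t => discPoint e p q (discOrbit η w t)) t) ↔
      Balanced k m η (discOrbit η w t) (discOrbit η w' t) := by
  have hne := (discOrbit_injective η t).ne h
  rw [← normSq_discOrbit η w t] at hw
  rw [← normSq_discOrbit η w' t] at hw'
  rw [deriv_velocity_discOrbit e p hq η (by rwa [normSq_discOrbit] at hw),
    velocity_discOrbit e p hq η (by rwa [normSq_discOrbit] at hw), coord_discPoint e p hq hw,
    coord_discPoint e p hq hw', acceleration_discMap k m p hq hw hw' hne,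
    mul_right_inj' (discDeriv_ne_zero hq hw), Balanced]
  have a1 := one_sub_ne_zero_of_normSq_lt hw
  have b1 : (1 : ℂ) - normSq (discOrbit η w t) ≠ 0 := by
    exact_mod_cast (by linarith : (1 : ℝ) - normSq (discOrbit η w t) ≠ 0)
  have hN := mul_conj (discOrbit η w t)
  generalize ((k * m / ((1 - normSq (discOrbit η w' t)) *
    discSinhDist (discOrbit η w t) (discOrbit η w' t) ^ 3) : ℝ) : ℂ) *
      ((discOrbit η w t - discOrbit η w' t) *
        (1 - discOrbit η w t * conj (discOrbit η w' t))) = K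
  push_cast
  generalize (normSq (discOrbit η w t) : ℂ) = N at *
  generalize conj (discOrbit η w t) = v at *
  generalize discOrbit η w t = W at *
  have key : -((η : ℂ) ^ 2 * W * ((1 + W) / (1 - W))) -
      2 * (1 - v) / ((1 - W) * (1 - N)) * (-(I * η) * W) ^ 2 =
      -(η ^ 2 * ((1 + N) / (1 - N)) * W) := by
    -- Here the relation `N = W * v` between norm and conjugate is essential.
    rw [mul_pow, neg_sq, mul_pow, I_sq, ← hN]
    rw [← hN] at b1
    field_simp
    ring
  constructor
  · intro h
    linear_combination key - h
  · intro h
    linear_combination key - h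

theorem isMotion_discOrbit_iff (k η : ℝ) {m₁ m₂ : ℝ} (hm₁ : m₁ ≠ 0) (hm₂ : m₂ ≠ 0) {w₁ w₂ : ℂ}
    (h₁ : normSq w₁ < 1) (h₂ : normSq w₂ < 1) (hne : w₁ ≠ w₂) :
    IsMotion e k m₁ m₂ (fun t => discPoint e p q (discOrbit η w₁ t))
        (fun t => discPoint e p q (discOrbit η w₂ t)) ↔
      Balanced k m₂ η w₁ w₂ ∧ Balanced k m₁ η w₂ w₁ := by
  have hne' : ∀ t, discPoint e p q (discOrbit η w₁ t) ≠ discPoint e p q (discOrbit η w₂ t) :=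
    fun t h => (discOrbit_injective η t).ne hne (discPoint_injective e p hq
      (by rwa [normSq_discOrbit]) (by rwa [normSq_discOrbit]) h)
  rw [isMotion_iff e k hm₁ hm₂ hne' ((contDiff_coord_discOrbit e p hq η h₁).prodMk
    (contDiff_coord_discOrbit e p hq η h₂))]
  simp only [deriv_velocity_discOrbit_eq_iff e p hq k _ η h₁ h₂ hne,
    deriv_velocity_discOrbit_eq_iff e p hq k _ η h₂ h₁ hne.symm]
  constructor
  · intro h
    have := h 0
    rwa [discOrbit_zero, discOrbit_zero] at this
  · intro h t
    exact ⟨h.1.rotate (normSq_exp_ofReal_mul_I _), h.2.rotate (normSq_exp_ofReal_mul_I _)⟩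

end Motion

/-! ### Solving the balance equations -/

theorem discSinhDist_tanh {u : ℂ} (hu : normSq u = 1) {r₁ r₂ : ℝ} (h : r₁ ≤ r₂) :
    discSinhDist ((Real.tanh (r₁ / 2) : ℝ) * u) ((Real.tanh (r₂ / 2) : ℝ) * u) =
      Real.sinh (r₂ - r₁) := by
  have hd := dist_discGeodesic (IsometryEquiv.refl UpperHalfPlane) 0 one_pos hu r₁ r₂
  rw [← sinhDist_discMap 0 one_pos (normSq_tanh_mul_unit r₁ hu) (normSq_tanh_mul_unit r₂ hu)]
  refine sinhDist_eq_sinh (by linarith) ?_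
  rw [← abs_of_nonneg (show 0 ≤ r₂ - r₁ by linarith), abs_sub_comm, ← hd, cosh_dist_eq_coord
    (IsometryEquiv.refl UpperHalfPlane), discGeodesic, discGeodesic,
    coord_discPoint _ 0 one_pos (normSq_tanh_mul_unit r₁ hu),
    coord_discPoint _ 0 one_pos (normSq_tanh_mul_unit r₂ hu)]
  rfl

/-- Both sides are real multiples of `u`. In half-angle variables `(t₁ + t₂)(1 + t₁t₂)` is `sinh (r₁
+ r₂)` up to the factors `1 - tᵢ²`, so one of its three powers cancels, and `2 sinh r₁ cosh r₁`
supplies `sinh (2 r₁)`. -/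
theorem balanced_opposite_iff (k m η : ℝ) {u : ℂ} (hu : normSq u = 1) {r₁ r₂ : ℝ} (h₁ : 0 < r₁)
    (h₂ : 0 < r₂) :
    Balanced k m η ((Real.tanh (-r₁ / 2) : ℝ) * u) ((Real.tanh (r₂ / 2) : ℝ) * u) ↔
      η ^ 2 = 2 * k * m / (Real.sinh (r₁ + r₂) ^ 2 * Real.sinh (2 * r₁)) := by
  have hu0 : u ≠ 0 := fun h => by simp [h] at hu
  have huc : u * conj u = 1 := by rw [mul_conj, hu, ofReal_one]
  have hs₁ := Real.sinh_pos_iff.2 h₁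
  have hS : 0 < Real.sinh (r₁ + r₂) := Real.sinh_pos_iff.2 (by linarith)
  have hc₁ := Real.cosh_pos r₁
  rw [Balanced, discSinhDist_tanh hu (by linarith), normSq_real_mul_unit _ hu,
    normSq_real_mul_unit _ hu, sub_neg_eq_add, add_comm r₂ r₁, Real.sinh_two_mul, neg_div,
    Real.tanh_neg, neg_sq]
  have hSt : Real.sinh (r₁ + r₂) = 2 * (Real.tanh (r₁ / 2) + Real.tanh (r₂ / 2)) *
      (1 + Real.tanh (r₁ / 2) * Real.tanh (r₂ / 2)) /
      ((1 - Real.tanh (r₁ / 2) ^ 2) * (1 - Real.tanh (r₂ / 2) ^ 2)) := by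
    have := (by linarith [tanh_half_sq_lt_one r₁] : 1 - Real.tanh (r₁ / 2) ^ 2 ≠ 0)
    have := (by linarith [tanh_half_sq_lt_one r₂] : 1 - Real.tanh (r₂ / 2) ^ 2 ≠ 0)
    rw [Real.sinh_add, sinh_eq_tanh_half r₁, cosh_eq_tanh_half r₂, sinh_eq_tanh_half r₂,
      cosh_eq_tanh_half r₁]
    field_simp
    ring
  have hc := cosh_eq_tanh_half r₁
  have hs := sinh_eq_tanh_half r₁
  have ht1 := (by linarith [tanh_half_sq_lt_one r₁] : 1 - Real.tanh (r₁ / 2) ^ 2 ≠ 0)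
  have ht2 := (by linarith [tanh_half_sq_lt_one r₂] : 1 - Real.tanh (r₂ / 2) ^ 2 ≠ 0)
  rw [← hc]
  generalize Real.tanh (r₁ / 2) = t₁ at *
  generalize Real.tanh (r₂ / 2) = t₂ at *
  generalize Real.sinh (r₁ + r₂) = S at *
  generalize Real.cosh r₁ = c at *
  generalize Real.sinh r₁ = s at *
  have hL : ((η ^ 2 * c : ℝ) : ℂ) * ((-t₁ : ℝ) * u) = ((η ^ 2 * c * (-t₁) : ℝ) : ℂ) * u := by
    push_cast; ring
  have hR : ((k * m / ((1 - t₂ ^ 2) * S ^ 3) : ℝ) : ℂ) *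
      (((-t₁ : ℝ) * u - (t₂ : ℝ) * u) * (1 - (-t₁ : ℝ) * u * conj ((t₂ : ℝ) * u))) =
      ((k * m / ((1 - t₂ ^ 2) * S ^ 3) * (-(t₁ + t₂) * (1 + t₁ * t₂)) : ℝ) : ℂ) * u := by
    have h1 : (1 : ℂ) - (-t₁ : ℝ) * u * conj ((t₂ : ℝ) * u) = 1 + t₁ * t₂ := by
      rw [map_mul, conj_ofReal]
      push_cast
      linear_combination (t₁ * t₂ : ℂ) * huc
    rw [h1]
    push_cast
    ring
  rw [hL, hR, mul_left_inj' hu0, ofReal_inj]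
  have hR' : k * m / ((1 - t₂ ^ 2) * S ^ 3) * (-(t₁ + t₂) * (1 + t₁ * t₂)) =
      -(k * m * (1 - t₁ ^ 2) / (2 * S ^ 2)) := by
    have h3 : (t₁ + t₂) * (1 + t₁ * t₂) = S * ((1 - t₁ ^ 2) * (1 - t₂ ^ 2)) / 2 := by
      rw [hSt]; field_simp
    have h4 : -(t₁ + t₂) * (1 + t₁ * t₂) = -(S * ((1 - t₁ ^ 2) * (1 - t₂ ^ 2)) / 2) := by
      rw [← h3]; ring
    rw [h4]
    field_simp
  rw [hR']
  have hst : t₁ = s * (1 - t₁ ^ 2) / 2 := by rw [hs]; field_simp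
  have hst' : η ^ 2 * c * -t₁ = -(η ^ 2 * c * s * (1 - t₁ ^ 2) / 2) := by
    linear_combination (-(η ^ 2 * c)) * hst
  rw [hst', neg_inj, eq_div_iff (by positivity), eq_div_iff (by positivity)]
  constructor
  · intro h
    apply mul_left_cancel₀ ht1
    linear_combination 2 * h
  · intro h
    linear_combination (1 - t₁ ^ 2) / 2 * h

/-- The balance of two particles forces them to opposite sides of the center of the disc. -/
theorem Balanced.exists_opposite {k m₁ m₂ η : ℝ} (hk : 0 < k) (hm₁ : 0 < m₁) (hm₂ : 0 < m₂)
    (hη : η ≠ 0) {w₁ w₂ : ℂ} (h₁ : normSq w₁ < 1) (h₂ : normSq w₂ < 1) (hne : w₁ ≠ w₂)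
    (hb₁ : Balanced k m₂ η w₁ w₂) (hb₂ : Balanced k m₁ η w₂ w₁) :
    ∃ (u : ℂ) (r₁ r₂ : ℝ), normSq u = 1 ∧ 0 < r₁ ∧ 0 < r₂ ∧
      w₁ = (Real.tanh (-r₁ / 2) : ℝ) * u ∧ w₂ = (Real.tanh (r₂ / 2) : ℝ) * u := by
  have key : ∀ {m : ℝ} {w w' : ℂ}, 0 < m → normSq w < 1 → normSq w' < 1 → w ≠ w' →
      Balanced k m η w w' → ∃ P : ℝ, 0 < P ∧ (w - w') * (1 - w * conj w') = P * w := by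
    intro m w w' hm hw hw' hww' hb
    have hS := discSinhDist_pos hw hw' hww'
    have hN := normSq_nonneg w
    have hB : 0 < k * m / ((1 - normSq w') * discSinhDist w w' ^ 3) := by
      have : 0 < 1 - normSq w' := by linarith
      positivity
    have hA : 0 < η ^ 2 * ((1 + normSq w) / (1 - normSq w)) := by
      have : 0 < 1 - normSq w := by linarith
      positivity
    have hB' : ((k * m / ((1 - normSq w') * discSinhDist w w' ^ 3) : ℝ) : ℂ) ≠ 0 := by
      exact_mod_cast hB.ne'
    refine ⟨_, div_pos hA hB, ?_⟩
    rw [ofReal_div, div_mul_eq_mul_div, eq_div_iff hB', mul_comm]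
    exact hb.symm
  obtain ⟨P₁, hP₁, e₁⟩ := key hm₂ h₁ h₂ hne hb₁
  obtain ⟨P₂, hP₂, e₂⟩ := key hm₁ h₂ h₁ hne.symm hb₂
  have hw₁ : w₁ ≠ 0 := by
    rintro rfl
    simp at e₁
    exact hne e₁.symm
  have hw₂ : w₂ ≠ 0 := by
    rintro rfl
    simp at e₂
    exact hne e₂
  have n₁ := normSq_pos.2 hw₁
  have n₂ := normSq_pos.2 hw₂
  have hc : w₁ * conj w₂ = conj (w₂ * conj w₁) := by simp [mul_comm]
  have hz : normSq (w₂ * conj w₁) = normSq w₁ * normSq w₂ := by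
    rw [normSq_mul, normSq_conj, mul_comm]
  -- Multiplying by `conj w₁` makes the right-hand side real and leaves `w₂ * conj w₁` as the only
  -- complex unknown.
  have f₁ : (normSq w₁ - w₂ * conj w₁) * (1 - conj (w₂ * conj w₁)) = ((P₁ * normSq w₁ : ℝ) : ℂ) := by
    rw [← hc, ofReal_mul, ← mul_conj]
    linear_combination conj w₁ * e₁
  have f₂ : (normSq w₂ - conj (w₂ * conj w₁)) * (1 - w₂ * conj w₁) = ((P₂ * normSq w₂ : ℝ) : ℂ) := by
    rw [← hc, ofReal_mul, ← mul_conj]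
    linear_combination conj w₂ * e₂
  set z := w₂ * conj w₁ with hz_def
  have him : z.im = 0 := by
    have := congrArg im f₁
    simp at this
    have h3 : z.im * (normSq w₁ - 1) = 0 := by linarith
    rcases mul_eq_zero.1 h3 with h | h
    · exact h
    · linarith
  have g₁ := congrArg re f₁
  have g₂ := congrArg re f₂
  simp [him] at g₁ g₂
  rw [normSq_apply, him, mul_zero, add_zero] at hz
  -- With `x = z.re`: `x² = |w₁|²|w₂|² < 1` gives `x < 1`, and then `f₁`, `f₂` give `x < |w₁|²` and
  -- `x < |w₂|²`. If `x ≥ 0`, multiplying these would contradict `x² = |w₁|²|w₂|²`.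
  have hz1 : z.re < 1 := by nlinarith
  have hz2 : z.re < normSq w₁ := by
    by_contra! hcon
    nlinarith [mul_pos hP₁ n₁]
  have hz3 : z.re < normSq w₂ := by
    by_contra! hcon
    nlinarith [mul_pos hP₂ n₂]
  have hz0 : z.re < 0 := by
    by_contra! hcon
    nlinarith [mul_pos n₁ n₂]
  obtain ⟨u, hu, r₂, hr₂, rfl⟩ := exists_eq_tanh_mul_unit h₂
  have hu0 : u ≠ 0 := fun h => by simp [h] at hu
  have huc : u * conj u = 1 := by rw [mul_conj, hu, ofReal_one]
  set t := Real.tanh (r₂ / 2) with ht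
  have ht0 : t ≠ 0 := by
    intro h
    simp [h] at hw₂
  have hr₂' : 0 < r₂ := by
    rcases hr₂.eq_or_lt with h | h
    · exact absurd (by simp [ht, ← h]) ht0
    · exact h
  have ht' : 0 < t := by
    rw [ht, Real.tanh_eq_sinh_div_cosh]
    exact div_pos (Real.sinh_pos_iff.2 (by linarith)) (Real.cosh_pos _)
  have hzr : z = (z.re : ℂ) := Complex.ext (by simp) (by simp [him])
  have ht0' : (t : ℂ) ≠ 0 := by exact_mod_cast ht0
  have hw₁u : w₁ = ((z.re / t : ℝ) : ℂ) * u := by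
    have h5 : conj w₁ = ((z.re / t : ℝ) : ℂ) * conj u := by
      rw [ofReal_div, ← hzr, hz_def]
      field_simp
      linear_combination (-conj w₁) * huc
    have h6 := congrArg conj h5
    rwa [conj_conj, map_mul, conj_ofReal, conj_conj] at h6
  have hτ : 0 < -(z.re / t) := by
    rw [← neg_div]
    exact div_pos (by linarith) ht'
  have hτ1 : -(z.re / t) < 1 := by
    rw [hw₁u, normSq_real_mul_unit _ hu] at h₁
    nlinarith
  refine ⟨u, 2 * Real.artanh (-(z.re / t)), r₂, hu, ?_, hr₂', ?_, rfl⟩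
  · have := Real.artanh_pos ⟨hτ, hτ1⟩
    positivity
  · rw [neg_div, mul_div_cancel_left₀ _ two_ne_zero, Real.tanh_neg,
      Real.tanh_artanh ⟨by linarith, hτ1⟩, neg_neg]
    exact hw₁u

/-! ### Elliptic elements of `sl(2, ℝ)` and rotations -/

/-- The generator of the rotations about `p + i q` with angular velocity `η`. -/
def rotationGenerator (p q η : ℝ) : Matrix (Fin 2) (Fin 2) ℝ :=
  (η / (2 * q)) • !![p, -(p ^ 2 + q ^ 2); 1, -p]

/-- The lift to `SL(2, ℝ)` of the rotation about `p + i q` by the angle `2 θ`. -/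
def rotationMatrix (p q θ : ℝ) : Matrix (Fin 2) (Fin 2) ℝ :=
  !![Real.cos θ + Real.sin θ * p / q, -(Real.sin θ * (p ^ 2 + q ^ 2) / q);
    Real.sin θ / q, Real.cos θ - Real.sin θ * p / q]

theorem det_rotationMatrix (p : ℝ) {q : ℝ} (hq : q ≠ 0) (θ : ℝ) :
    (rotationMatrix p q θ).det = 1 := by
  rw [rotationMatrix, Matrix.det_fin_two_of]
  field_simp
  linear_combination q ^ 2 * Real.sin_sq_add_cos_sq θ

/-- A square root of `-1` gives a continuous algebra map from `ℂ` with `I ↦ A`; Euler's formula is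
carried over by it. -/
theorem exp_smul_of_mul_self {A : Matrix (Fin 2) (Fin 2) ℝ} (hA : A * A = -1) (s : ℝ) :
    NormedSpace.exp (s • A) = Real.cos s • (1 : Matrix (Fin 2) (Fin 2) ℝ) + Real.sin s • A := by
  have hf : Continuous (Complex.liftAux A hA) :=
    (Complex.liftAux A hA).toLinearMap.continuous_of_finiteDimensional
  have h := ((NormedSpace.exp_series_hasSum_exp' (𝕂 := ℝ) (s * I : ℂ)).map
    (Complex.liftAux A hA) hf).tsum_eq
  have hsA : Complex.liftAux A hA (s * I) = s • A := by
    rw [Complex.liftAux_apply]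
    simp
  have hterm : (fun n : ℕ => ((n.factorial : ℝ)⁻¹) • (s • A) ^ n) =
      Complex.liftAux A hA ∘ fun n : ℕ => ((n.factorial : ℝ)⁻¹) • (s * I : ℂ) ^ n := by
    funext n
    rw [Function.comp_apply, map_smul, map_pow, hsA]
  rw [NormedSpace.exp_eq_tsum ℝ]
  simp only
  rw [hterm, h, ← Complex.exp_eq_exp_ℂ, Complex.liftAux_apply, Complex.exp_ofReal_mul_I_re,
    Complex.exp_ofReal_mul_I_im, Algebra.algebraMap_eq_smul_one]

theorem exp_smul_rotationGenerator (p : ℝ) {q : ℝ} (hq : q ≠ 0) (η t : ℝ) :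
    NormedSpace.exp (t • rotationGenerator p q η) = rotationMatrix p q (η * t / 2) := by
  have hA : (q⁻¹ • !![p, -(p ^ 2 + q ^ 2); 1, -p]) * (q⁻¹ • !![p, -(p ^ 2 + q ^ 2); 1, -p]) =
      (-1 : Matrix (Fin 2) (Fin 2) ℝ) := by
    ext i j
    fin_cases i <;> fin_cases j <;> simp [Matrix.mul_apply, Fin.sum_univ_two] <;> field_simp <;>
      ring
  have h : t • rotationGenerator p q η =
      (η * t / 2) • (q⁻¹ • !![p, -(p ^ 2 + q ^ 2); 1, -p]) := by
    rw [rotationGenerator, smul_smul, smul_smul]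
    congr 1
    field_simp
  rw [h, exp_smul_of_mul_self hA, rotationMatrix]
  ext i j
  fin_cases i <;> fin_cases j <;> simp <;> ring

/-- The Cayley map conjugates the Möbius action to a rotation. Since `w` is multiplied by the
quotient of `cos θ - i sin θ` and `cos θ + i sin θ`, the matrix carries half the angle. -/
theorem discMap_discOrbit (p : ℝ) {q : ℝ} (hq : 0 < q) (η t : ℝ) {w : ℂ} (hw : normSq w < 1)
    {g : Matrix.SpecialLinearGroup (Fin 2) ℝ} (hg : (g : Matrix (Fin 2) (Fin 2) ℝ) =
      rotationMatrix p q (η * t / 2)) {z : UpperHalfPlane} (hz : (z : ℂ) = discMap p q w) :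
    ((g • z : UpperHalfPlane) : ℂ) = discMap p q (discOrbit η w t) := by
  have hq' : (q : ℂ) ≠ 0 := by exact_mod_cast hq.ne'
  have a1 := one_sub_ne_zero_of_normSq_lt hw
  have hw' : normSq (discOrbit η w t) < 1 := by rwa [normSq_discOrbit]
  have a2 := one_sub_ne_zero_of_normSq_lt hw'
  rw [UpperHalfPlane.coe_specialLinearGroup_apply, hg, hz]
  set θ := η * t / 2 with hθ
  have hcs : (Real.cos θ : ℂ) ^ 2 + (Real.sin θ : ℂ) ^ 2 = 1 := by
    exact_mod_cast Real.cos_sq_add_sin_sq θ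
  have hprod : ((Real.cos θ : ℂ) - Real.sin θ * I) * (Real.cos θ + Real.sin θ * I) = 1 := by
    linear_combination hcs - (Real.sin θ : ℂ) ^ 2 * I_sq
  have hne : (Real.cos θ : ℂ) + Real.sin θ * I ≠ 0 := right_ne_zero_of_mul_eq_one hprod
  have hζ : discOrbit η w t * (Real.cos θ + Real.sin θ * I) =
      (Real.cos θ - Real.sin θ * I) * w := by
    have h1 : (Real.cos θ : ℂ) - Real.sin θ * I = exp (-(θ * I)) := by
      rw [← neg_mul, exp_mul_I, Complex.cos_neg, Complex.sin_neg, ofReal_cos, ofReal_sin]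
      ring
    have h2 : (Real.cos θ : ℂ) + Real.sin θ * I = exp (θ * I) := by
      rw [exp_mul_I, ofReal_cos, ofReal_sin]
    rw [h1, h2, discOrbit, mul_right_comm, ← exp_add]
    congr 2
    rw [hθ]
    push_cast
    ring
  simp only [rotationMatrix, Matrix.of_apply, Matrix.cons_val', Matrix.cons_val_zero,
    Matrix.cons_val_one, Matrix.cons_val_fin_one, Algebra.algebraMap_self, RingHom.id_apply]
  generalize discOrbit η w t = W at *
  have hW : W = (Real.cos θ - Real.sin θ * I) * w / (Real.cos θ + Real.sin θ * I) := by
    rw [eq_div_iff hne, hζ]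
  push_cast at *
  generalize (Complex.cos θ) = c at *
  generalize (Complex.sin θ) = s at *
  have hden : s / q * discMap p q w + (c - s * p / q) =
      ((c + s * I) - (c - s * I) * w) / (1 - w) := by
    rw [discMap]
    field_simp
    ring
  have hden' : (c + s * I) - (c - s * I) * w = (1 - W) * (c + s * I) := by
    linear_combination hζ
  rw [hden, div_eq_iff (by rw [hden']; exact div_ne_zero (mul_ne_zero a2 hne) a1), hden']
  simp only [discMap]
  field_simp
  linear_combination (-(q * (q * I - p))) * hζ - q ^ 2 * s * (1 - w) * I_sq

/-- The characteristic polynomial of a traceless matrix is `μ² + det A`. Ellipticity thus becomes a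
condition on the determinant alone. -/
theorem spectrum_map_ofReal (A : Matrix (Fin 2) (Fin 2) ℝ) (hA : A.trace = 0) (μ : ℂ) :
    μ ∈ spectrum ℂ (A.map (fun x => (x : ℂ))) ↔ μ ^ 2 = -(A.det : ℂ) := by
  have htr : A 1 1 = -A 0 0 := by
    rw [Matrix.trace_fin_two] at hA
    linarith
  rw [spectrum.mem_iff, Matrix.isUnit_iff_isUnit_det, isUnit_iff_ne_zero, not_not,
    Matrix.det_fin_two, Matrix.det_fin_two, Algebra.algebraMap_eq_smul_one]
  simp [htr]
  constructor <;> (intro h; linear_combination h)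

theorem isEllipticElement_iff (ξ : LieAlgebra.SpecialLinear.sl (Fin 2) ℝ) {ω : ℝ} (hω : ω ≠ 0) :
    IsEllipticElement ξ ω ↔ (ξ : Matrix (Fin 2) (Fin 2) ℝ).det = ω ^ 2 / 4 := by
  have htr : (ξ : Matrix (Fin 2) (Fin 2) ℝ).trace = 0 := ξ.2
  have hsq : (I * (ω / 2)) ^ 2 = -((ω ^ 2 / 4 : ℝ) : ℂ) := by
    push_cast
    rw [mul_pow, I_sq]
    ring
  constructor
  · rintro ⟨-, h⟩
    have h1 : I * (ω / 2) ∈ spectrum ℂ ((ξ : Matrix (Fin 2) (Fin 2) ℝ).map (fun x => (x : ℂ))) := by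
      rw [h]; simp
    rw [spectrum_map_ofReal _ htr, hsq] at h1
    exact_mod_cast (neg_injective h1).symm
  · intro h
    refine ⟨hω, Set.ext fun μ => ?_⟩
    rw [spectrum_map_ofReal _ htr, h, ← hsq, sq_eq_sq_iff_eq_or_eq_neg]
    rfl

theorem det_rotationGenerator (p : ℝ) {q : ℝ} (hq : q ≠ 0) (η : ℝ) :
    (rotationGenerator p q η).det = η ^ 2 / 4 := by
  rw [rotationGenerator, Matrix.det_smul, Matrix.det_fin_two_of, Fintype.card_fin]
  field_simp
  ring

theorem trace_rotationGenerator (p q η : ℝ) : (rotationGenerator p q η).trace = 0 := by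
  rw [rotationGenerator, Matrix.trace_smul, Matrix.trace_fin_two_of, add_neg_cancel, smul_zero]

/-- An elliptic element generates the rotations about a point of the upper half-plane. -/
theorem IsEllipticElement.exists_eq_rotationGenerator
    {ξ : LieAlgebra.SpecialLinear.sl (Fin 2) ℝ} {ω : ℝ} (h : IsEllipticElement ξ ω) :
    ∃ p q η : ℝ, 0 < q ∧ |η| = |ω| ∧
      (ξ : Matrix (Fin 2) (Fin 2) ℝ) = rotationGenerator p q η := by
  have hω := h.1
  have hdet := (isEllipticElement_iff ξ hω).1 h
  have htr : (ξ : Matrix (Fin 2) (Fin 2) ℝ).trace = 0 := ξ.2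
  set A := (ξ : Matrix (Fin 2) (Fin 2) ℝ)
  rw [Matrix.trace_fin_two] at htr
  rw [Matrix.det_fin_two] at hdet
  have h11 : A 1 1 = -A 0 0 := by linarith
  have hω2 : 0 < ω ^ 2 := by positivity
  -- Otherwise the determinant would be `-(A 0 0)² ≤ 0`.
  have hc : A 1 0 ≠ 0 := by
    intro hc
    rw [hc, h11] at hdet
    nlinarith [sq_nonneg (A 0 0)]
  -- The eigenvalues determine `ω` only up to sign; the sign of `η` is chosen to put the fixed point
  -- `A 0 0 / A 1 0 + i η / (2 A 1 0)` in the upper half-plane.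
  obtain ⟨η, hη, hηc⟩ : ∃ η : ℝ, |η| = |ω| ∧ 0 < η / A 1 0 := by
    rcases lt_or_gt_of_ne (div_ne_zero hω hc) with hlt | hgt
    · exact ⟨-ω, abs_neg ω, by rw [neg_div]; linarith⟩
    · exact ⟨ω, rfl, hgt⟩
  have hη0 : η ≠ 0 := fun h0 => by simp [h0] at hηc
  have hη2 : η ^ 2 = ω ^ 2 := sq_eq_sq_iff_abs_eq_abs _ _ |>.2 hη
  refine ⟨A 0 0 / A 1 0, η / A 1 0 / 2, η, by positivity, hη, ?_⟩
  have hs : η / (2 * (η / A 1 0 / 2)) = A 1 0 := by field_simp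
  rw [rotationGenerator, hs]
  have h01 : A 0 1 = -(A 0 0 ^ 2 + η ^ 2 / 4) / A 1 0 := by
    rw [eq_div_iff hc, hη2]
    rw [h11] at hdet
    linarith
  ext i j
  fin_cases i <;> fin_cases j <;> simp [h11, h01] <;> field_simp
  ring

/-! ### Relative equilibria on opposite sides of the center -/

section RelativeEquilibrium

variable {M : Type*} [MetricSpace M] (e : M ≃ᵢ UpperHalfPlane)

theorem discOrbit_real_mul (η a : ℝ) (u : ℂ) (t : ℝ) :
    discOrbit η (a * u) t = a * discOrbit η u t := by
  rw [discOrbit, discOrbit, mul_left_comm]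

theorem discPoint_discOrbit_tanh (p q η r : ℝ) (u : ℂ) (t : ℝ) :
    discPoint e p q (discOrbit η ((Real.tanh (r / 2) : ℝ) * u) t) =
      discGeodesic e p q (discOrbit η u t) r := by
  rw [discOrbit_real_mul, discGeodesic]

/-- The relative equilibria generated by the rotations about `p + i q`. -/
theorem isEllipticRelEq_iff_of_eq_rotationGenerator {k m₁ m₂ : ℝ} {p q η ω : ℝ}
    (hq : 0 < q) (hω : ω ≠ 0) (hη : |η| = |ω|) {ξ : LieAlgebra.SpecialLinear.sl (Fin 2) ℝ}
    (hξ : (ξ : Matrix (Fin 2) (Fin 2) ℝ) = rotationGenerator p q η) (q₁ q₂ : ℝ → M) :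
    IsEllipticRelEq e k m₁ m₂ q₁ q₂ ξ ω ↔ IsMotion e k m₁ m₂ q₁ q₂ ∧
      ∃ w₁ w₂, normSq w₁ < 1 ∧ normSq w₂ < 1 ∧
        q₁ = (fun t => discPoint e p q (discOrbit η w₁ t)) ∧
        q₂ = fun t => discPoint e p q (discOrbit η w₂ t) := by
  have hell : IsEllipticElement ξ ω := by
    rw [isEllipticElement_iff ξ hω, hξ, det_rotationGenerator p hq.ne',
      (sq_eq_sq_iff_abs_eq_abs _ _).2 hη]
  have hcoord : ∀ {w : ℂ}, normSq w < 1 → ∀ (g : Matrix.SpecialLinearGroup (Fin 2) ℝ) (t : ℝ),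
      (g : Matrix (Fin 2) (Fin 2) ℝ) = rotationMatrix p q (η * t / 2) →
      g • e (discPoint e p q w) = e (discPoint e p q (discOrbit η w t)) := by
    intro w hw g t hg
    apply UpperHalfPlane.ext
    rw [discMap_discOrbit p hq η t hw hg (coord_discPoint e p hq hw)]
    exact (coord_discPoint e p hq (by rwa [normSq_discOrbit])).symm
  rw [IsEllipticRelEq, hξ]
  simp only [exp_smul_rotationGenerator p hq.ne', hell, true_and]
  refine and_congr_right fun _ => ?_
  constructor
  · rintro ⟨g, hg⟩
    obtain ⟨w₁, hw₁, h₁⟩ := exists_discPoint_eq e p hq (q₁ 0)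
    obtain ⟨w₂, hw₂, h₂⟩ := exists_discPoint_eq e p hq (q₂ 0)
    refine ⟨w₁, w₂, hw₁, hw₂, funext fun t => e.injective ?_, funext fun t => e.injective ?_⟩
    · rw [(hg t).2.1, ← h₁, hcoord hw₁ _ t (hg t).1]
    · rw [(hg t).2.2, ← h₂, hcoord hw₂ _ t (hg t).1]
  · rintro ⟨w₁, w₂, hw₁, hw₂, rfl, rfl⟩
    have hex : ∀ t, ∃ g : Matrix.SpecialLinearGroup (Fin 2) ℝ,
        (g : Matrix (Fin 2) (Fin 2) ℝ) = rotationMatrix p q (η * t / 2) :=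
      fun t => ⟨⟨_, det_rotationMatrix p hq.ne' (η * t / 2)⟩, rfl⟩
    choose g hg using hex
    refine ⟨g, fun t => ⟨hg t, ?_, ?_⟩⟩
    · simp only [discOrbit_zero]
      rw [hcoord hw₁ _ t (hg t)]
    · simp only [discOrbit_zero]
      rw [hcoord hw₂ _ t (hg t)]

theorem isMotion_opposite_iff (k : ℝ) {m₁ m₂ p q η ω : ℝ} (hm₁ : m₁ ≠ 0) (hm₂ : m₂ ≠ 0)
    (hq : 0 < q) (hη : |η| = |ω|) {u : ℂ} (hu : normSq u = 1) {r₁ r₂ : ℝ} (h₁ : 0 < r₁)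
    (h₂ : 0 < r₂) :
    IsMotion e k m₁ m₂
        (fun t => discPoint e p q (discOrbit η ((Real.tanh (-r₁ / 2) : ℝ) * u) t))
        (fun t => discPoint e p q (discOrbit η ((Real.tanh (r₂ / 2) : ℝ) * u) t)) ↔
      OmegaRelation k m₁ m₂ r₁ r₂ ω := by
  have hne : ((Real.tanh (-r₁ / 2) : ℝ) : ℂ) * u ≠ (Real.tanh (r₂ / 2) : ℝ) * u := by
    intro h
    have := (isGeodesic_discGeodesic (IsometryEquiv.refl UpperHalfPlane) 0 one_pos hu).injective
      (congrArg (discPoint _ 0 1) h : discGeodesic _ 0 1 u (-r₁) = discGeodesic _ 0 1 u r₂)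
    linarith
  have hη2 : η ^ 2 = ω ^ 2 := (sq_eq_sq_iff_abs_eq_abs _ _).2 hη
  -- The second particle's equation is the first one's with the diameter reversed.
  have hb₂ := balanced_opposite_iff k m₁ η (u := -u) (by rwa [normSq_neg]) h₂ h₁
  have e₁ : ((Real.tanh (-r₂ / 2) : ℝ) : ℂ) * -u = (Real.tanh (r₂ / 2) : ℝ) * u := by
    rw [neg_div, Real.tanh_neg]; push_cast; ring
  have e₂ : ((Real.tanh (r₁ / 2) : ℝ) : ℂ) * -u = (Real.tanh (-r₁ / 2) : ℝ) * u := by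
    rw [neg_div, Real.tanh_neg]; push_cast; ring
  rw [e₁, e₂] at hb₂
  rw [isMotion_discOrbit_iff e p hq k η hm₁ hm₂ (normSq_tanh_mul_unit _ hu)
    (normSq_tanh_mul_unit _ hu) hne, balanced_opposite_iff k m₂ η hu h₁ h₂, hb₂, OmegaRelation,
    hη2, add_comm r₂ r₁, and_comm]

/-- Equating the two values of `ω²` leaves the center-of-mass condition. -/
theorem OmegaRelation.mul_sinh_eq {k m₁ m₂ r₁ r₂ ω : ℝ} (hk : k ≠ 0) (h₁ : 0 < r₁) (h₂ : 0 < r₂)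
    (h : OmegaRelation k m₁ m₂ r₁ r₂ ω) :
    m₁ * Real.sinh (2 * r₁) = m₂ * Real.sinh (2 * r₂) := by
  have a1 := Real.sinh_pos_iff.2 (by linarith : 0 < 2 * r₁)
  have a2 := Real.sinh_pos_iff.2 (by linarith : 0 < 2 * r₂)
  have a3 := Real.sinh_pos_iff.2 (by linarith : 0 < r₁ + r₂)
  have := h.1.symm.trans h.2
  rw [div_eq_div_iff (by positivity) (by positivity)] at this
  have hS : 2 * k * Real.sinh (r₁ + r₂) ^ 2 ≠ 0 := by positivity
  apply mul_left_cancel₀ hS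
  linear_combination this

theorem metricNorm_velocity_discOrbit {p q : ℝ} (hq : 0 < q) (η : ℝ) {u : ℂ} (hu : normSq u = 1)
    (r t : ℝ) :
    metricNorm (coord e (discPoint e p q (discOrbit η ((Real.tanh (r / 2) : ℝ) * u) t)))
        (velocity e (fun t => discPoint e p q (discOrbit η ((Real.tanh (r / 2) : ℝ) * u) t)) t) =
      |η| * |Real.sinh r| := by
  have hw := normSq_tanh_mul_unit r hu
  have hw' : normSq (discOrbit η ((Real.tanh (r / 2) : ℝ) * u) t) < 1 := by rwa [normSq_discOrbit]
  have hu' : ‖u‖ = 1 := by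
    rw [← Complex.sq_norm] at hu
    exact (pow_eq_one_iff_of_nonneg (norm_nonneg u) two_ne_zero).1 hu
  have h1 : 0 < 1 - Real.tanh (r / 2) ^ 2 := by linarith [tanh_half_sq_lt_one r]
  rw [velocity_discOrbit e p hq η hw, coord_discPoint e p hq hw', metricNorm_discDeriv p hq hw',
    normSq_discOrbit, normSq_real_mul_unit _ hu, discOrbit, sinh_eq_tanh_half, abs_div, abs_mul,
    abs_of_pos h1]
  simp only [norm_mul, norm_neg, norm_I, norm_real, norm_exp_ofReal_mul_I, hu', Real.norm_eq_abs]
  rw [abs_two]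
  ring

/-- The disc velocity `-iηw` is perpendicular to the diameter and changes direction with the sign of
`tanh (r / 2)`, that is, across the center. -/
theorem perpOpposite_velocity_discOrbit {p q : ℝ} (hq : 0 < q) {η : ℝ} (hη : η ≠ 0) {u : ℂ}
    (hu : normSq u = 1) {r₁ r₂ : ℝ} (h₁ : 0 < r₁) (h₂ : 0 < r₂) (t : ℝ) :
    PerpOpposite e (discPoint e p q (discOrbit η ((Real.tanh (-r₁ / 2) : ℝ) * u) t))
      (discPoint e p q (discOrbit η ((Real.tanh (r₂ / 2) : ℝ) * u) t))
      (velocity e (fun t => discPoint e p q (discOrbit η ((Real.tanh (-r₁ / 2) : ℝ) * u) t)) t)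
      (velocity e (fun t => discPoint e p q (discOrbit η ((Real.tanh (r₂ / 2) : ℝ) * u) t)) t) := by
  have hu' : normSq (discOrbit η u t) = 1 := by rwa [normSq_discOrbit]
  rw [velocity_discOrbit e p hq η (normSq_tanh_mul_unit _ hu),
    velocity_discOrbit e p hq η (normSq_tanh_mul_unit _ hu), discPoint_discOrbit_tanh,
    discPoint_discOrbit_tanh, discOrbit_real_mul, discOrbit_real_mul,
    perpOpposite_iff e p hq hu' (by linarith)]
  have key : ∀ r : ℝ, -(I * η) * ((Real.tanh (r / 2) : ℝ) * discOrbit η u t) *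
      conj (discOrbit η u t) = ((-(η * Real.tanh (r / 2)) : ℝ) : ℂ) * I := by
    intro r
    have := mul_conj (discOrbit η u t)
    rw [hu', ofReal_one] at this
    push_cast
    linear_combination (-(I * η * Complex.tanh (r / 2))) * this
  have ht : ∀ {r : ℝ}, 0 < r → 0 < Real.tanh (r / 2) := fun {r} hr => by
    rw [Real.tanh_eq_sinh_div_cosh]
    exact div_pos (Real.sinh_pos_iff.2 (by linarith)) (Real.cosh_pos _)
  rw [key, key]
  simp only [re_ofReal_mul, im_ofReal_mul, I_re, I_im, mul_zero, mul_one, true_and]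
  rw [neg_div, Real.tanh_neg]
  have := mul_pos (mul_pos (ht h₁) (ht h₂)) (by positivity : 0 < η ^ 2)
  linarith

end RelativeEquilibrium

/-! ### Periods and initial velocities -/

section Main

variable {M : Type*} [MetricSpace M] (e : M ≃ᵢ UpperHalfPlane)

theorem periodic_discOrbit (p q : ℝ) {η : ℝ} (hη : η ≠ 0) (w : ℂ) :
    Function.Periodic (fun t => discPoint e p q (discOrbit η w t)) (2 * Real.pi / |η|) := by
  intro t
  have h : ∃ n : ℤ, η * (2 * Real.pi / |η|) = n * (2 * Real.pi) := by
    rcases abs_choice η with h | h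
    · exact ⟨1, by rw [h]; field_simp; norm_num⟩
    · exact ⟨-1, by rw [h]; field_simp; norm_num⟩
  obtain ⟨n, hn⟩ := h
  have : discOrbit η w (t + 2 * Real.pi / |η|) = discOrbit η w t := by
    rw [discOrbit, discOrbit, mul_add, hn]
    congr 1
    rw [exp_eq_exp_iff_exists_int]
    exact ⟨-n, by push_cast; ring⟩
  simp only [this]

theorem le_of_periodic_discOrbit (p : ℝ) {q η : ℝ} (hq : 0 < q) (hη : η ≠ 0) {w : ℂ}
    (hw : normSq w < 1) (hw0 : w ≠ 0) {T : ℝ} (hT : 0 < T)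
    (h : Function.Periodic (fun t => discPoint e p q (discOrbit η w t)) T) :
    2 * Real.pi / |η| ≤ T := by
  -- The return to the initial point already makes `ηT` a nonzero integer multiple of `2π`.
  have h0 := discPoint_injective e p hq (by rwa [normSq_discOrbit]) (by rwa [normSq_discOrbit]) (h 0)
  rw [zero_add, discOrbit_zero, discOrbit, mul_eq_right₀ hw0, exp_eq_one_iff] at h0
  obtain ⟨n, hn⟩ := h0
  have hn' : -(η * T) = n * (2 * Real.pi) := by
    have := congrArg im hn
    simpa using this
  have hn0 : n ≠ 0 := by
    rintro rfl
    have : η * T ≠ 0 := mul_ne_zero hη hT.ne'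
    simp at hn'
    exact this (by rcases hn' with h | h <;> simp [h])
  have h1 : (1 : ℝ) ≤ |(n : ℝ)| := by exact_mod_cast Int.one_le_abs hn0
  have h2 := congrArg abs hn'
  rw [abs_neg, abs_mul, abs_mul, abs_of_pos hT, abs_of_pos Real.two_pi_pos] at h2
  rw [div_le_iff₀' (abs_pos.2 hη), h2]
  nlinarith [Real.two_pi_pos]

/-- Oppositely oriented velocities perpendicular to the geodesic, of the norms `|ω| sinh rᵢ`, are
those of a rotation about the center. -/
theorem PerpOpposite.exists_rotation {p q ω : ℝ} (hq : 0 < q) {u : ℂ} (hu : normSq u = 1)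
    {r₁ r₂ : ℝ} (h₁ : 0 < r₁) (h₂ : 0 < r₂) {V₁ V₂ : ℂ}
    (h : PerpOpposite e (discGeodesic e p q u (-r₁)) (discGeodesic e p q u r₂) V₁ V₂)
    (hV₁ : metricNorm (coord e (discGeodesic e p q u (-r₁))) V₁ = |ω| * Real.sinh r₁)
    (hV₂ : metricNorm (coord e (discGeodesic e p q u r₂)) V₂ = |ω| * Real.sinh r₂) :
    ∃ η : ℝ, |η| = |ω| ∧
      discDeriv q ((Real.tanh (-r₁ / 2) : ℝ) * u) *
        (-(I * η) * ((Real.tanh (-r₁ / 2) : ℝ) * u)) = V₁ ∧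
      discDeriv q ((Real.tanh (r₂ / 2) : ℝ) * u) *
        (-(I * η) * ((Real.tanh (r₂ / 2) : ℝ) * u)) = V₂ := by
  have hw := fun r => normSq_tanh_mul_unit r hu
  have huc : conj u * u = 1 := by rw [mul_comm, mul_conj, hu, ofReal_one]
  have hu' : ‖conj u‖ = 1 := by
    rw [← normSq_conj, ← Complex.sq_norm] at hu
    exact (pow_eq_one_iff_of_nonneg (norm_nonneg _) two_ne_zero).1 hu
  obtain ⟨α₁, rfl⟩ : ∃ α, discDeriv q ((Real.tanh (-r₁ / 2) : ℝ) * u) * α = V₁ :=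
    ⟨_, mul_div_cancel₀ V₁ (discDeriv_ne_zero hq (hw _))⟩
  obtain ⟨α₂, rfl⟩ : ∃ α, discDeriv q ((Real.tanh (r₂ / 2) : ℝ) * u) * α = V₂ :=
    ⟨_, mul_div_cancel₀ V₂ (discDeriv_ne_zero hq (hw _))⟩
  obtain ⟨p₁, p₂, ho⟩ := (perpOpposite_iff e p hq hu (by linarith) α₁ α₂).1 h
  have ht : ∀ {r : ℝ}, 0 < r → 0 < Real.tanh (r / 2) := fun {r} hr => by
    rw [Real.tanh_eq_sinh_div_cosh]
    exact div_pos (Real.sinh_pos_iff.2 (by linarith)) (Real.cosh_pos _)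
  have key : ∀ {α : ℂ}, (α * conj u).re = 0 →
      α = I * (α * conj u).im * u ∧ ‖α‖ = |(α * conj u).im| := by
    intro α hα
    have h1 : α * conj u = I * (α * conj u).im := by
      apply Complex.ext <;> simp [hα]
    constructor
    · rw [← h1, mul_assoc, huc, mul_one]
    · calc ‖α‖ = ‖α * conj u‖ := by rw [norm_mul, hu', mul_one]
        _ = ‖I * ((α * conj u).im : ℂ)‖ := congrArg norm h1
        _ = |(α * conj u).im| := by rw [norm_mul, norm_I, one_mul, norm_real, Real.norm_eq_abs]
  obtain ⟨a₁, n₁⟩ := key p₁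
  obtain ⟨a₂, n₂⟩ := key p₂
  have norm_eq : ∀ {α : ℂ} {r s : ℝ}, 1 - Real.tanh (r / 2) ^ 2 = 1 - Real.tanh (s / 2) ^ 2 →
      metricNorm (coord e (discGeodesic e p q u s))
        (discDeriv q ((Real.tanh (s / 2) : ℝ) * u) * α) = |ω| * Real.sinh r →
      ‖α‖ = |ω| * Real.tanh (r / 2) := by
    intro α r s hrs hV
    have h1 : 0 < 1 - Real.tanh (r / 2) ^ 2 := by linarith [tanh_half_sq_lt_one r]
    rw [discGeodesic, coord_discPoint e p hq (hw s), metricNorm_discDeriv p hq (hw s),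
      normSq_real_mul_unit _ hu, ← hrs, sinh_eq_tanh_half] at hV
    field_simp at hV
    linarith
  have l₁ := norm_eq (by rw [neg_div, Real.tanh_neg, neg_sq]) hV₁
  have l₂ := norm_eq rfl hV₂
  rw [n₁] at l₁
  rw [n₂] at l₂
  set y₁ := (α₁ * conj u).im
  set y₂ := (α₂ * conj u).im
  set t₁ := Real.tanh (r₁ / 2) with ht₁
  set t₂ := Real.tanh (r₂ / 2)
  have t₁_pos : 0 < t₁ := ht h₁
  have t₂_pos : 0 < t₂ := ht h₂
  -- Since `|yᵢ| = |ω| tᵢ` and the signs are opposite, `y₁ / t₁` and `-y₂ / t₂` are the same angular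
  -- velocity, the witness for `η`.
  have hcross : y₂ = -(y₁ / t₁ * t₂) := by
    rw [eq_neg_iff_add_eq_zero, div_mul_eq_mul_div, ← eq_neg_iff_add_eq_zero, ← neg_div,
      eq_div_iff t₁_pos.ne']
    rcases mul_neg_iff.1 ho with ⟨hp, hn⟩ | ⟨hn, hp⟩
    · rw [abs_of_pos hp] at l₁
      rw [abs_of_neg hn] at l₂
      rw [l₁]
      linear_combination (-t₁) * l₂
    · rw [abs_of_neg hn] at l₁
      rw [abs_of_pos hp] at l₂
      rw [l₂]
      linear_combination (-t₂) * l₁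
  refine ⟨y₁ / t₁, ?_, ?_, ?_⟩
  · rw [abs_div, l₁, abs_of_pos t₁_pos, mul_div_cancel_right₀ _ t₁_pos.ne']
  · congr 1
    rw [a₁, neg_div, Real.tanh_neg, ← ht₁]
    have : (t₁ : ℂ) ≠ 0 := by exact_mod_cast t₁_pos.ne'
    push_cast
    field_simp
  · congr 1
    rw [a₂, hcross]
    push_cast
    ring

end Main

end

end HypTwoBody

/-! ### The main theorem -/

open HypTwoBody in
theorem mainTheorem4 {M : Type*} [MetricSpace M] (e : M ≃ᵢ UpperHalfPlane) (k m₁ m₂ : ℝ)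
    (hk : 0 < k) (hm₁ : 0 < m₁) (hm₂ : 0 < m₂) :
    -- every elliptic relative equilibrium is of the described form
    (∀ (q₁ q₂ : ℝ → M) (ξ : LieAlgebra.SpecialLinear.sl (Fin 2) ℝ) (ω : ℝ),
      HypTwoBody.IsEllipticRelEq e k m₁ m₂ q₁ q₂ ξ ω →
      ∃ (C : M) (d₁ d₂ : ℝ),
        -- the center of mass is fixed
        (∀ t, HypTwoBody.IsCenterOfMass m₁ m₂ (q₁ t) (q₂ t) C ∧
          ∀ C', HypTwoBody.IsCenterOfMass m₁ m₂ (q₁ t) (q₂ t) C' → C' = C) ∧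
        -- the distances are constant
        (∀ t, dist (q₁ t) C = d₁ ∧ dist (q₂ t) C = d₂ ∧ dist (q₁ t) (q₂ t) = d₁ + d₂) ∧
        HypTwoBody.OmegaRelation k m₁ m₂ d₁ d₂ ω ∧
        -- the velocities
        (∀ t, HypTwoBody.PerpOpposite e (q₁ t) (q₂ t)
            (HypTwoBody.velocity e q₁ t) (HypTwoBody.velocity e q₂ t) ∧
          HypTwoBody.metricNorm (HypTwoBody.coord e (q₁ t)) (HypTwoBody.velocity e q₁ t) =
            |ω| * Real.sinh d₁ ∧
          HypTwoBody.metricNorm (HypTwoBody.coord e (q₂ t)) (HypTwoBody.velocity e q₂ t) =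
            |ω| * Real.sinh d₂) ∧
        -- the (least) period is 2π / |ω|
        Function.Periodic q₁ (2 * Real.pi / |ω|) ∧ Function.Periodic q₂ (2 * Real.pi / |ω|) ∧
        ∀ T : ℝ, 0 < T → Function.Periodic q₁ T → Function.Periodic q₂ T →
          2 * Real.pi / |ω| ≤ T) ∧
    -- conversely, the described initial data give rise to an elliptic relative equilibrium
    (∀ X₁ X₂ : M, X₁ ≠ X₂ →
      ∃ C : M, HypTwoBody.IsCenterOfMass m₁ m₂ X₁ X₂ C ∧
        (∀ C', HypTwoBody.IsCenterOfMass m₁ m₂ X₁ X₂ C' → C' = C) ∧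
        ∀ ω : ℝ, HypTwoBody.OmegaRelation k m₁ m₂ (dist X₁ C) (dist X₂ C) ω →
        ∀ V₁ V₂ : ℂ, HypTwoBody.PerpOpposite e X₁ X₂ V₁ V₂ →
          HypTwoBody.metricNorm (HypTwoBody.coord e X₁) V₁ = |ω| * Real.sinh (dist X₁ C) →
          HypTwoBody.metricNorm (HypTwoBody.coord e X₂) V₂ = |ω| * Real.sinh (dist X₂ C) →
          ∃ q₁ q₂ : ℝ → M,
            (∃ ξ, HypTwoBody.IsEllipticRelEq e k m₁ m₂ q₁ q₂ ξ ω) ∧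
            q₁ 0 = X₁ ∧ q₂ 0 = X₂ ∧
            HypTwoBody.velocity e q₁ 0 = V₁ ∧ HypTwoBody.velocity e q₂ 0 = V₂ ∧
            ∀ p₁ p₂ : ℝ → M, HypTwoBody.IsMotion e k m₁ m₂ p₁ p₂ →
              p₁ 0 = X₁ → p₂ 0 = X₂ →
              HypTwoBody.velocity e p₁ 0 = V₁ → HypTwoBody.velocity e p₂ 0 = V₂ →
              p₁ = q₁ ∧ p₂ = q₂) := by
  refine ⟨?_, ?_⟩
  · intro q₁ q₂ ξ ω h
    have hω : ω ≠ 0 := h.2.1.1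
    obtain ⟨p, q, η, hq, hη, hξ⟩ := h.2.1.exists_eq_rotationGenerator
    have hη0 : η ≠ 0 := by
      rw [← abs_pos, hη]
      exact abs_pos.2 hω
    obtain ⟨hmot, w₁, w₂, hw₁, hw₂, rfl, rfl⟩ :=
      (isEllipticRelEq_iff_of_eq_rotationGenerator e hq hω hη hξ q₁ q₂).1 h
    have hne : w₁ ≠ w₂ := by
      rintro rfl
      exact hmot.ne 0 rfl
    obtain ⟨hb₁, hb₂⟩ := (isMotion_discOrbit_iff e p hq k η hm₁.ne' hm₂.ne' hw₁ hw₂ hne).1 hmot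
    obtain ⟨u, r₁, r₂, hu, hr₁, hr₂, rfl, rfl⟩ :=
      hb₁.exists_opposite hk hm₁ hm₂ hη0 hw₁ hw₂ hne hb₂
    have hΩ := (isMotion_opposite_iff e k hm₁.ne' hm₂.ne' hq hη hu hr₁ hr₂).1 hmot
    have hm := hΩ.mul_sinh_eq hk.ne' hr₁ hr₂
    -- The second particle is off the center, so its orbit alone bounds the period from below.
    have hw0 : ((Real.tanh (r₂ / 2) : ℝ) : ℂ) * u ≠ 0 := by
      have hu0 : u ≠ 0 := fun h => by simp [h] at hu
      have : Real.tanh (r₂ / 2) ≠ 0 := by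
        rw [Real.tanh_eq_sinh_div_cosh]
        exact (div_pos (Real.sinh_pos_iff.2 (by linarith)) (Real.cosh_pos _)).ne'
      exact mul_ne_zero (by exact_mod_cast this) hu0
    refine ⟨discPoint e p q 0, r₁, r₂, fun t => ?_, fun t => ?_, hΩ, fun t => ⟨?_, ?_, ?_⟩,
      ?_, ?_, fun T hT _ hT₂ => ?_⟩
    · have hut : Complex.normSq (discOrbit η u t) = 1 := by rwa [normSq_discOrbit]
      simp only [discPoint_discOrbit_tanh]
      exact ⟨isCenterOfMass_discPoint_zero e p hq hut hr₁.le hr₂.le hm, fun C' hC' =>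
        hC'.eq_discPoint_zero e p hq hm₁ hm₂ hut hr₁ hr₂ hm⟩
    · have hut : Complex.normSq (discOrbit η u t) = 1 := by rwa [normSq_discOrbit]
      simp only [discPoint_discOrbit_tanh]
      rw [dist_discGeodesic_center e p hq hut, dist_discGeodesic_center e p hq hut,
        dist_discGeodesic e p hq hut, abs_neg, abs_of_pos hr₁, abs_of_pos hr₂, abs_sub_comm,
        sub_neg_eq_add, abs_of_pos (by linarith), add_comm r₂]
      exact ⟨rfl, rfl, rfl⟩
    · exact perpOpposite_velocity_discOrbit e hq hη0 hu hr₁ hr₂ t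
    · rw [metricNorm_velocity_discOrbit e hq η hu, hη, Real.sinh_neg, abs_neg,
        abs_of_pos (Real.sinh_pos_iff.2 hr₁)]
    · rw [metricNorm_velocity_discOrbit e hq η hu, hη, abs_of_pos (Real.sinh_pos_iff.2 hr₂)]
    · rw [← hη]
      exact periodic_discOrbit e p q hη0 _
    · rw [← hη]
      exact periodic_discOrbit e p q hη0 _
    · rw [← hη]
      exact le_of_periodic_discOrbit e p hq hη0 hw₂ hw0 hT hT₂
  · intro X₁ X₂ hX
    obtain ⟨p, q, u, r₁, r₂, hq, hu, hr₁, hr₂, hm, rfl, rfl⟩ :=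
      exists_center_of_mass_coordinates e hm₁ hm₂ hX
    refine ⟨discPoint e p q 0, isCenterOfMass_discPoint_zero e p hq hu hr₁.le hr₂.le hm,
      fun C' hC' => hC'.eq_discPoint_zero e p hq hm₁ hm₂ hu hr₁ hr₂ hm, ?_⟩
    rw [dist_discGeodesic_center e p hq hu, dist_discGeodesic_center e p hq hu, abs_neg,
      abs_of_pos hr₁, abs_of_pos hr₂]
    intro ω hΩ V₁ V₂ hperp hV₁ hV₂
    obtain ⟨η, hη, rfl, rfl⟩ := hperp.exists_rotation e hq hu hr₁ hr₂ hV₁ hV₂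
    have hω : ω ≠ 0 := by
      rintro rfl
      have := hΩ.1
      have a2 := Real.sinh_pos_iff.2 (by linarith : 0 < 2 * r₂)
      have a3 := Real.sinh_pos_iff.2 (by linarith : 0 < r₁ + r₂)
      have : 0 < 2 * k * m₁ / (Real.sinh (r₁ + r₂) ^ 2 * Real.sinh (2 * r₂)) := by positivity
      linarith
    have hmot := (isMotion_opposite_iff e (p := p) k hm₁.ne' hm₂.ne' hq hη hu hr₁ hr₂).2 hΩ
    have hw₁ := normSq_tanh_mul_unit (-r₁) hu
    have hw₂ := normSq_tanh_mul_unit r₂ hu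
    have hv₁ := velocity_discOrbit e p hq η hw₁ 0
    have hv₂ := velocity_discOrbit e p hq η hw₂ 0
    rw [discOrbit_zero] at hv₁ hv₂
    refine ⟨_, _, ⟨⟨rotationGenerator p q η, trace_rotationGenerator p q η⟩,
      (isEllipticRelEq_iff_of_eq_rotationGenerator e hq hω hη rfl _ _).2
        ⟨hmot, _, _, hw₁, hw₂, rfl, rfl⟩⟩, ?_, ?_, hv₁, hv₂, ?_⟩
    · simp only [discOrbit_zero]
      rfl
    · simp only [discOrbit_zero]
      rfl
    · intro p₁ p₂ hp h₁ h₂ hpv₁ hpv₂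
      refine hmot.eq_of_initial e k hm₁.ne' hm₂.ne' hp ?_ ?_ (hpv₁.trans hv₁.symm)
        (hpv₂.trans hv₂.symm)
      · simp only [discOrbit_zero]
        exact h₁
      · simp only [discOrbit_zero]
        exact h₂
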